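/- Setting. Let $\Omega\subset\mathbb R^n$ ($n\ge 1$) be a bounded convex domain, $F:\mathbb R^{n\times n}\times\mathbb R^n\times\mathbb R\times\Omega\to\mathbb R$ differentiable in all its arguments, $g$ a function on $\partial\Omega$. Write $V=H^2(\Omega)$, $V_0=H^2(\Omega)\cap H^1_0(\Omega)$, $V_g=\{v\in V: v|_{\partial\Omega}=g\}$, $F(w)=F(D^2w,\nabla w,w,x)$, and $F'[w](v)=F_r:D^2v+F_p\cdot\nabla v+F_z v$ with the partial derivatives taken at $(D^2w,\nabla w,w,x)$. For $\varepsilon>0$ a solution of the vanishing moment problem is $u\in V_g$ with $$\varepsilon(\Delta u,\Delta v)+(F(u),v)=\langle\varepsilon^2,\partial v/\partial\nu\rangle_{\partial\Omega}\qquad\forall v\in V_0. \tag{1}$$ Put $\langle G_\varepsilon'[u](v),w\rangle=\varepsilon(\Delta v,\Delta w)+\langle F'[u](v),w\rangle$ for $v,w\in V_0$, and $\|B\|_{VV^*}=\sup_{v,w\in V_0}\langle B(v),w\rangle/(\|v\|_{H^2}\|w\|_{H^2})$. Finite elements. Let $V^h\subset V$ be finite element spaces of piecewise polynomials of degree $k>4$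 on quasiuniform partitions of $\Omega$ into simplices or rectangles of size $h$, with $h$ in a set of positive mesh sizes. Let $V^h_g=\{v_h\in V^h: v_h|_{\partial\Omega}=g\}$ and $V^h_0=\{v_h\in V^h: v_h|_{\partial\Omega}=0\}$. Let $I_h:V\to V^h$ be interpolation operators with $I_h(V_0)\subset V^h_0$ which, for $\sigma=s$ and for $\sigma=p$ (with $s,p$ as below), satisfy $\|v-I_hv\|_{H^j}\le Ch^{\min\{\sigma,k+1\}-j}\|v\|_{H^{\min\{\sigma,k+1\}}}$ for $j=0,1,2$ and $v\in V\cap H^\sigma(\Omega)$. Write $\tilde u=I_hu^\varepsilon$ and assume $\tilde u\in V^h_g$. The method is: find $u_h^\varepsilon\in V^h_g$ such that (1) holds for $u=u^\varepsilon_h$ and all $v\in V^h_0$. Assumptions. - [A1] There is $\varepsilon_0\in(0,1)$ such that for every $\varepsilon\in(0,\varepsilon_0]$, $u^\varepsilon\in H^s(\Omega)$, $s\ge3$, is a locally unique solution of the vanishing moment problem. - [A2] For $\varepsilon\in(0,\varepsilon_0]$: $(G'_\varepsilon[u^\varepsilon])^*:V_0\to V_0^*$ is an isomorphism; there are constants $C_0(\varepsilon)\ge0$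 and $C_1(\varepsilon),C_2(\varepsilon),C_R(\varepsilon)>0$ and $p>2$ with $\langle G_\varepsilon'[u^\varepsilon](v),v\rangle\ge C_1\|v\|_{H^2}^2-C_0\|v\|_{L^2}^2$ on $V_0$ and $\|F'[u^\varepsilon]\|_{VV^*}\le C_2$; and if $\varphi\in L^2(\Omega)$ and $v\in V_0$ satisfy $(G_\varepsilon'[u^\varepsilon])^*(v)=\varphi$, then $v\in H^p(\Omega)$ and $\|v\|_{H^p}\le C_R\|\varphi\|_{L^2}$. - [A3] There is a normed (e.g. Banach) space $Y\subset V$ containing all $V^h$ and $u^\varepsilon$ with $\|F'[y]\|_{VV^*}\le C\|y\|_Y$ for all $y\in Y$, $C$ independent of $\varepsilon$. - [A4] $\|\tilde u\|_Y\le C\|u^\varepsilon\|_Y$ with $C$ independent of $\varepsilon$ and $h$. - [A5] There are $\delta=\delta(\varepsilon)\in(0,1)$ and $L(h)=L(\varepsilon,h)\ge0$, $L(h)=o(h^{2-\ell})$ as $h\to0$, such that $\|F'[u^\varepsilon]-F'[w_h]\|_{VV^*}\le L(h)\|u^\varepsilon-w_h\|_{H^2}$ for all $w_h\in V^h_g$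 with $\|\tilde u-w_h\|_{H^2}\le\delta$. Here $\ell=\min\{s,k+1\}$, $r=\min\{p,k+1\}$. It is understood that $F'$ is the derivative of the operator $F$: the integrals $\langle F'[y](v),z\rangle$ ($y\in Y$, $v,z\in V_0$) and $(F(w),z)$ ($w\in Y\cap V_g$, $z\in V_0$) are well defined, and $\frac{d}{dt}(F(w+tv),z)|_{t=0}=\langle F'[w](v),z\rangle$ for $w\in Y\cap V_g$, $v\in Y\cap V_0$, $z\in V_0$. The constants are normalized so that, for some $\kappa$ independent of $\varepsilon$, $\varepsilon\le\kappa C_2(\varepsilon)$ and $\max\{\varepsilon,C_1(\varepsilon)\}\le\kappa\|u^\varepsilon\|_Y$. Theorem. Put $M=\max\{C_1^{-1/2},C_0^{1/2}C_R\}$ and $K=C_1^{-1/2}\|u^\varepsilon\|_YM$. There are constants $c,C>0$ independent of $\varepsilon$ and $h$ such that for all $\varepsilon\in(0,\varepsilon_0]$ the following holds. Let $h_0=c\,(C_0C_1^{-1}C_2^2C_R^2)^{1/(4-2r)}$ if $C_0\ne0$ and $h_0=1$ if $C_0=0$, and consider the conditions $$\text{(H2)}\quad K\|u^\varepsilon\|_{H^\ell}\max\{\delta^{-1},C_1^{-1/2}L(h)M\}\,h^{\ell-2}\le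 c,\qquad\text{(H3)}\quad K\delta^{-1}\|u^\varepsilon\|_{H^\ell}\,h^{\ell-2}\le c .$$ There are $h_2(\varepsilon)>0$, $h_3(\varepsilon)>0$ such that (H2) holds for all $h\le h_2$ and (H3) for all $h\le h_3$. For every mesh size $h\le h_0$ satisfying (H2), the method has a locally unique solution $u^\varepsilon_h\in V^h_g$ (the only solution in some ball $\{v_h\in V^h_g:\|\tilde u-v_h\|_{H^2}\le\rho\}$ with $\rho>\|\tilde u-u_h^\varepsilon\|_{H^2}$), and with $C_7=CK$ $$\|u^\varepsilon-u^\varepsilon_h\|_{H^2}\le C_7h^{\ell-2}\|u^\varepsilon\|_{H^\ell}.$$ If moreover $h$ satisfies (H3), and the Lipschitz bound of [A5] also holds on segments, i.e. $\|F'[u^\varepsilon]-F'[y]\|_{VV^*}\le L(h)\|u^\varepsilon-y\|_{H^2}$ for $y=u^\varepsilon+\gamma(w_h-u^\varepsilon)$, $\gamma\in[0,1]$, $w_h$ as in [A5], then $$\|u^\varepsilon-u_h^\varepsilon\|_{L^2}\le C\,K\,C_R\Big(C_2h^{\ell+r-4}\|u^\varepsilon\|_{H^\ell}+L(h)\,K\,h^{2\ell-4}\|u^\varepsilon\|_{H^\ell}^2\Big).$$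 -/

import Mathlib

open MeasureTheory Filter Topology Set
open scoped ENNReal ContDiff

noncomputable section

namespace VMM

/-- The space `ℝⁿ` with its Euclidean norm. -/
abbrev E (n : ℕ) := EuclideanSpace ℝ (Fin n)

/-- The real Hilbert space `L²(Ω)`. -/
abbrev L2 {n : ℕ} (Ω : Set (E n)) := Lp ℝ 2 ((volume : Measure (E n)).restrict Ω)

section Sobolev

variable {n : ℕ} (Ω : Set (E n))

/-- `i`-th standard basis vector. -/
abbrev e (i : Fin n) : E n := EuclideanSpace.single i 1

/-- `g ∈ L²(Ω)` is the weak derivative `∂_{α 0} ⋯ ∂_{α (m-1)} f` of `f ∈ L²(Ω)`: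
`∫_Ω f ∂_α φ = (-1)^m ∫_Ω g φ` for all test functions `φ ∈ C_c^∞(Ω)`. -/
def IsWeakDeriv {m : ℕ} (α : Fin m → Fin n) (f g : L2 Ω) : Prop :=
  ∀ φ : E n → ℝ, ContDiff ℝ ∞ φ → HasCompactSupport φ → tsupport φ ⊆ Ω →
    ∫ x in Ω, f x * iteratedFDeriv ℝ m φ x (fun i => e (α i)) =
      (-1) ^ m * ∫ x in Ω, g x * φ x

open Classical in
/-- The weak derivative of `f` along the multi-index `α` (zero if there is none in `L²(Ω)`). -/
def wD {m : ℕ} (α : Fin m → Fin n) (f : L2 Ω) : L2 Ω :=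
  if h : ∃ g, IsWeakDeriv Ω α f g then h.choose else 0

lemma integrable_mul_test (f : L2 Ω) {ψ : E n → ℝ} (hψ : Continuous ψ)
    (hs : HasCompactSupport ψ) : Integrable (fun x => f x * ψ x) (volume.restrict Ω) :=
  (Lp.memLp f).integrable_mul ((hψ.memLp_of_hasCompactSupport hs (p := 2)).restrict Ω)

lemma continuous_iter {m : ℕ} (α : Fin m → Fin n) {φ : E n → ℝ} (hφ : ContDiff ℝ ∞ φ) :
    Continuous (fun x => iteratedFDeriv ℝ m φ x (fun i => e (α i))) :=
  (ContinuousMultilinearMap.apply ℝ (fun _ : Fin m => E n) ℝ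
    (fun i => e (α i))).continuous.comp (hφ.continuous_iteratedFDeriv (by exact_mod_cast le_top))

lemma compact_iter {m : ℕ} (α : Fin m → Fin n) {φ : E n → ℝ} (hφ : HasCompactSupport φ) :
    HasCompactSupport (fun x => iteratedFDeriv ℝ m φ x (fun i => e (α i))) :=
  (hφ.iteratedFDeriv (𝕜 := ℝ) m).comp_left
    (g := fun A : ContinuousMultilinearMap ℝ (fun _ : Fin m => E n) ℝ => A (fun i => e (α i))) rfl

variable {Ω}

lemma IsWeakDeriv.add {m : ℕ} {α : Fin m → Fin n} {f f' g g' : L2 Ω}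
    (h : IsWeakDeriv Ω α f g) (h' : IsWeakDeriv Ω α f' g') :
    IsWeakDeriv Ω α (f + f') (g + g') := by
  intro φ hφ hc hs
  have key : ∀ (a b : L2 Ω) (ψ : E n → ℝ), Continuous ψ → HasCompactSupport ψ →
      ∫ x in Ω, (a + b : L2 Ω) x * ψ x = (∫ x in Ω, a x * ψ x) + ∫ x in Ω, b x * ψ x := by
    intro a b ψ h1 h2
    rw [← integral_add (integrable_mul_test Ω a h1 h2) (integrable_mul_test Ω b h1 h2)]
    refine integral_congr_ae ?_
    filter_upwards [Lp.coeFn_add a b] with x hx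
    rw [hx, Pi.add_apply, add_mul]
  rw [key _ _ _ (continuous_iter α hφ) (compact_iter α hc), key _ _ _ hφ.continuous hc,
    h φ hφ hc hs, h' φ hφ hc hs, mul_add]

lemma IsWeakDeriv.smul {m : ℕ} {α : Fin m → Fin n} {f g : L2 Ω} (c : ℝ)
    (h : IsWeakDeriv Ω α f g) : IsWeakDeriv Ω α (c • f) (c • g) := by
  intro φ hφ hc hs
  have key : ∀ (a : L2 Ω) (ψ : E n → ℝ),
      ∫ x in Ω, (c • a : L2 Ω) x * ψ x = c * ∫ x in Ω, a x * ψ x := by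
    intro a ψ
    rw [← integral_const_mul]
    refine integral_congr_ae ?_
    filter_upwards [Lp.coeFn_smul c a] with x hx
    rw [hx, Pi.smul_apply, smul_eq_mul, mul_assoc]
  rw [key, key, h φ hφ hc hs]
  ring

lemma IsWeakDeriv.zero {m : ℕ} {α : Fin m → Fin n} : IsWeakDeriv Ω α (0 : L2 Ω) 0 := by
  intro φ _ _ _
  have key : ∀ ψ : E n → ℝ, ∫ x in Ω, (0 : L2 Ω) x * ψ x = 0 := by
    intro ψ
    rw [← integral_zero (E n) ℝ (μ := volume.restrict Ω)]
    refine integral_congr_ae ?_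
    filter_upwards [Lp.coeFn_zero ℝ 2 ((volume : Measure (E n)).restrict Ω)] with x hx
    rw [hx, Pi.zero_apply, zero_mul]
  rw [key, key, mul_zero]

variable (Ω)

/-- The Sobolev space `H^m(Ω)`, `m ∈ ℕ`. -/
def H (m : ℕ) : Submodule ℝ (L2 Ω) where
  carrier := {f | ∀ j ≤ m, ∀ α : Fin j → Fin n, ∃ g, IsWeakDeriv Ω α f g}
  add_mem' := fun ha hb j hj α => by
    obtain ⟨g, hg⟩ := ha j hj α
    obtain ⟨g', hg'⟩ := hb j hj α
    exact ⟨g + g', hg.add hg'⟩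
  zero_mem' := fun _ _ _ => ⟨0, IsWeakDeriv.zero⟩
  smul_mem' := fun c f hf j hj α => by
    obtain ⟨g, hg⟩ := hf j hj α
    exact ⟨c • g, hg.smul c⟩

/-- The norm of `H^m(Ω)`: `‖f‖² = ∑_{j ≤ m} ‖D^j f‖²_{L²}`. -/
def hNorm (m : ℕ) (f : L2 Ω) : ℝ :=
  Real.sqrt (∑ j ∈ Finset.range (m + 1), ∑ α : Fin j → Fin n, ‖wD Ω α f‖ ^ 2)

/-- The squared Gagliardo–Slobodeckij seminorm of order `σ ∈ (0,1)`. -/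
def gagliardo (σ : ℝ) (f : L2 Ω) : ℝ≥0∞ :=
  ∫⁻ x in Ω, ∫⁻ y in Ω, ENNReal.ofReal ((f x - f y) ^ 2 / dist x y ^ ((n : ℝ) + 2 * σ))

/-- Membership in the Sobolev–Slobodeckij space `H^s(Ω)` for a real number `s ≥ 0`. -/
def MemHs (s : ℝ) (f : L2 Ω) : Prop :=
  f ∈ H Ω ⌊s⌋₊ ∧
    (Int.fract s ≠ 0 → ∀ α : Fin ⌊s⌋₊ → Fin n, gagliardo Ω (Int.fract s) (wD Ω α f) ≠ ⊤)

open Classical in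
/-- The norm of `H^s(Ω)` for a real number `s ≥ 0`. For integers `s` it is `hNorm`. -/
def hsNorm (s : ℝ) (f : L2 Ω) : ℝ :=
  Real.sqrt (hNorm Ω ⌊s⌋₊ f ^ 2 +
    if Int.fract s = 0 then 0
    else ∑ α : Fin ⌊s⌋₊ → Fin n, (gagliardo Ω (Int.fract s) (wD Ω α f)).toReal)

/-- Surface measure on `∂Ω`: the `(n-1)`-dimensional Hausdorff measure, normalized so as to be
the usual area. -/
def surf : Measure (E n) := (Measure.euclideanHausdorffMeasure (n - 1)).restrict (frontier Ω)

/-- `f ∈ H¹(Ω)` has the trace `t ∈ L²(∂Ω)` on `∂Ω`: there are smooth functions `φ_k` on `ℝⁿ`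
with `φ_k → f` in `H¹(Ω)` and `φ_k|_{∂Ω} → t` in `L²(∂Ω)`. -/
def HasTrace (f : L2 Ω) (t : E n → ℝ) : Prop :=
  MemLp t 2 (surf Ω) ∧ ∃ G : Fin n → L2 Ω, (∀ i, IsWeakDeriv Ω ![i] f (G i)) ∧
    ∃ φ : ℕ → E n → ℝ, (∀ k, ContDiff ℝ ∞ (φ k)) ∧
      Tendsto (fun k => eLpNorm (fun x => φ k x - f x) 2 (volume.restrict Ω)) atTop (𝓝 0) ∧
      (∀ i, Tendsto (fun k => eLpNorm (fun x => fderiv ℝ (φ k) x (e i) - G i x) 2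
        (volume.restrict Ω)) atTop (𝓝 0)) ∧
      Tendsto (fun k => eLpNorm (fun x => φ k x - t x) 2 (surf Ω)) atTop (𝓝 0)

variable {Ω}

lemma tendsto_eLpNorm_add {μ : Measure (E n)} {a b : ℕ → E n → ℝ}
    (ha : ∀ k, AEStronglyMeasurable (a k) μ) (hb : ∀ k, AEStronglyMeasurable (b k) μ)
    (h : Tendsto (fun k => eLpNorm (a k) 2 μ) atTop (𝓝 0))
    (h' : Tendsto (fun k => eLpNorm (b k) 2 μ) atTop (𝓝 0)) :
    Tendsto (fun k => eLpNorm (a k + b k) 2 μ) atTop (𝓝 0) :=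
  tendsto_of_tendsto_of_tendsto_of_le_of_le tendsto_const_nhds (by simpa using h.add h')
    (fun _ => zero_le) (fun k => eLpNorm_add_le (ha k) (hb k) (by norm_num))

lemma tendsto_eLpNorm_smul {μ : Measure (E n)} {a : ℕ → E n → ℝ} (c : ℝ)
    (h : Tendsto (fun k => eLpNorm (a k) 2 μ) atTop (𝓝 0)) :
    Tendsto (fun k => eLpNorm (c • a k) 2 μ) atTop (𝓝 0) := by
  simp only [eLpNorm_const_smul]
  simpa using ENNReal.Tendsto.const_mul (a := ‖c‖ₑ) h (Or.inr (by simp))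

lemma continuous_fderiv_e {φ : E n → ℝ} (hφ : ContDiff ℝ ∞ φ) (i : Fin n) :
    Continuous (fun x => fderiv ℝ φ x (e i)) :=
  (hφ.continuous_fderiv (by simp)).clm_apply continuous_const

lemma HasTrace.add {f f' : L2 Ω} {t t' : E n → ℝ} (h : HasTrace Ω f t)
    (h' : HasTrace Ω f' t') : HasTrace Ω (f + f') (t + t') := by
  obtain ⟨ht, G, hG, φ, hφ, h0, h1, h2⟩ := h
  obtain ⟨ht', G', hG', φ', hφ', h0', h1', h2'⟩ := h'
  refine ⟨ht.add ht', fun i => G i + G' i, fun i => (hG i).add (hG' i), fun k => φ k + φ' k,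
    fun k => (hφ k).add (hφ' k), ?_, fun i => ?_, ?_⟩
  · refine (tendsto_eLpNorm_add (fun k => ?_) (fun k => ?_) h0 h0').congr fun k => ?_
    · exact (hφ k).continuous.aestronglyMeasurable.sub (Lp.aestronglyMeasurable f)
    · exact (hφ' k).continuous.aestronglyMeasurable.sub (Lp.aestronglyMeasurable f')
    · refine eLpNorm_congr_ae ?_
      filter_upwards [Lp.coeFn_add f f'] with x hx
      simp only [Pi.add_apply, hx]
      ring
  · refine (tendsto_eLpNorm_add (fun k => ?_) (fun k => ?_) (h1 i) (h1' i)).congr fun k => ?_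
    · exact (continuous_fderiv_e (hφ k) i).aestronglyMeasurable.sub (Lp.aestronglyMeasurable _)
    · exact (continuous_fderiv_e (hφ' k) i).aestronglyMeasurable.sub (Lp.aestronglyMeasurable _)
    · refine eLpNorm_congr_ae ?_
      filter_upwards [Lp.coeFn_add (G i) (G' i)] with x hx
      rw [hx, fderiv_add ((hφ k).differentiable (by simp) x) ((hφ' k).differentiable (by simp) x)]
      simp only [Pi.add_apply, add_apply]
      ring
  · refine (tendsto_eLpNorm_add (fun k => ?_) (fun k => ?_) h2 h2').congr fun k => ?_
    · exact (hφ k).continuous.aestronglyMeasurable.sub ht.1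
    · exact (hφ' k).continuous.aestronglyMeasurable.sub ht'.1
    · congr 1
      ext x
      simp only [Pi.add_apply]
      ring

lemma HasTrace.smul {f : L2 Ω} {t : E n → ℝ} (c : ℝ) (h : HasTrace Ω f t) :
    HasTrace Ω (c • f) (c • t) := by
  obtain ⟨ht, G, hG, φ, hφ, h0, h1, h2⟩ := h
  refine ⟨ht.const_smul c, fun i => c • G i, fun i => (hG i).smul c, fun k => c • φ k,
    fun k => contDiff_const.smul (hφ k), ?_, fun i => ?_, ?_⟩
  · refine (tendsto_eLpNorm_smul c h0).congr fun k => ?_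
    refine eLpNorm_congr_ae ?_
    filter_upwards [Lp.coeFn_smul c f] with x hx
    simp only [Pi.smul_apply, smul_eq_mul, hx]
    ring
  · refine (tendsto_eLpNorm_smul c (h1 i)).congr fun k => ?_
    refine eLpNorm_congr_ae ?_
    filter_upwards [Lp.coeFn_smul c (G i)] with x hx
    rw [hx, fderiv_const_smul ((hφ k).differentiable (by simp) x)]
    simp only [Pi.smul_apply, smul_eq_mul, smul_apply]
    ring
  · refine (tendsto_eLpNorm_smul c h2).congr fun k => ?_
    congr 1
    ext x
    simp only [Pi.smul_apply, smul_eq_mul]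
    ring

lemma HasTrace.zero : HasTrace Ω (0 : L2 Ω) 0 := by
  have key : ∀ ψ : E n → ℝ, ψ = 0 →
      eLpNorm (fun x => ψ x - (0 : L2 Ω) x) 2 (volume.restrict Ω) = 0 := by
    rintro ψ rfl
    rw [← eLpNorm_zero (p := 2) (μ := (volume : Measure (E n)).restrict Ω) (ε := ℝ)]
    refine eLpNorm_congr_ae ?_
    filter_upwards [Lp.coeFn_zero ℝ 2 ((volume : Measure (E n)).restrict Ω)] with x hx
    rw [hx]
    simp
  refine ⟨MemLp.zero, fun _ => 0, fun _ => IsWeakDeriv.zero, fun _ => 0,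
    fun _ => contDiff_const, ?_, fun i => ?_, ?_⟩
  · exact tendsto_const_nhds.congr fun k => (key 0 rfl).symm
  · exact tendsto_const_nhds.congr fun k => (key _ (by ext x; simp)).symm
  · simp

variable (Ω)

/-- `V₀ = H²(Ω) ∩ H¹₀(Ω)`, where `H¹₀(Ω)` consists of the `H¹` functions with zero trace. -/
def V0 : Submodule ℝ (L2 Ω) where
  carrier := {f | f ∈ H Ω 2 ∧ HasTrace Ω f 0}
  add_mem' := fun ha hb => ⟨add_mem ha.1 hb.1, by simpa using ha.2.add hb.2⟩
  zero_mem' := ⟨zero_mem _, HasTrace.zero⟩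
  smul_mem' := fun c f hf => ⟨Submodule.smul_mem _ c hf.1, by simpa using hf.2.smul c⟩

/-- `V_g = {v ∈ H²(Ω) : v = g on ∂Ω}`. -/
def Vg (g : E n → ℝ) : Set (L2 Ω) := {f | f ∈ H Ω 2 ∧ HasTrace Ω f g}

/-- The Laplacian of `f ∈ H²(Ω)`. -/
def lap (f : L2 Ω) : L2 Ω := ∑ i, wD Ω ![i, i] f

/-- The Hessian `D²f(x)`. -/
def hess (f : L2 Ω) (x : E n) : Fin n → Fin n → ℝ := fun i j => wD Ω ![i, j] f x

/-- The gradient `∇f(x)`. -/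
def grad (f : L2 Ω) (x : E n) : E n := WithLp.toLp 2 fun i => wD Ω ![i] f x

open Classical in
/-- The trace of `f ∈ H¹(Ω)` on `∂Ω`. -/
def trace (f : L2 Ω) : E n → ℝ := if h : ∃ t, HasTrace Ω f t then h.choose else 0

open Classical in
/-- The outward unit normal of a convex domain `Ω` at `x ∈ ∂Ω` (wherever it is unique, that is,
almost everywhere on `∂Ω`). -/
def outerNormal (x : E n) : E n :=
  if h : ∃! ν : E n, ‖ν‖ = 1 ∧ ∀ y ∈ Ω, inner ℝ (y - x) ν ≤ 0 then h.choose else 0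

/-- The normal derivative `∂v/∂ν` on `∂Ω` of `v ∈ H²(Ω)`. -/
def normalDeriv (v : L2 Ω) (x : E n) : ℝ := ∑ i, trace Ω (wD Ω ![i] v) x * outerNormal Ω x i

end Sobolev

section Equation

variable {n : ℕ} (Ω : Set (E n)) (F : (Fin n → Fin n → ℝ) → E n → ℝ → E n → ℝ)

/-- `F` is differentiable in all its arguments `(r, p, z, x)`, `x ∈ Ω`. -/
def DifferentiableNonlinearity : Prop :=
  ∀ r p z, ∀ x ∈ Ω, DifferentiableAt ℝ
    (fun q : (Fin n → Fin n → ℝ) × E n × ℝ × E n => F q.1 q.2.1 q.2.2.1 q.2.2.2) (r, p, z, x)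

/-- `F(w) = F(D²w, ∇w, w, x)`. -/
def opF (w : L2 Ω) (x : E n) : ℝ := F (hess Ω w x) (grad Ω w x) (w x) x

/-- `F'[w](v) = F_r : D²v + F_p · ∇v + F_z v`, with the partial derivatives of `F` taken at
`(D²w, ∇w, w, x)`. -/
def opF' (w v : L2 Ω) (x : E n) : ℝ :=
  fderiv ℝ (fun r => F r (grad Ω w x) (w x) x) (hess Ω w x) (hess Ω v x) +
  fderiv ℝ (fun p => F (hess Ω w x) p (w x) x) (grad Ω w x) (grad Ω v x) +
  deriv (fun z => F (hess Ω w x) (grad Ω w x) z x) (w x) * v x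

/-- `(F(w), z)`. -/
def pairF (w z : L2 Ω) : ℝ := ∫ x in Ω, opF Ω F w x * z x

/-- `⟨F'[w](v), z⟩`. -/
def pairF' (w v z : L2 Ω) : ℝ := ∫ x in Ω, opF' Ω F w v x * z x

/-- `⟨G_ε'[u](v), w⟩ = ε (Δv, Δw) + ⟨F'[u](v), w⟩` for `v, w ∈ V₀`. -/
def pairG' (ε : ℝ) (u v w : L2 Ω) : ℝ :=
  ε * inner ℝ (lap Ω v) (lap Ω w) + pairF' Ω F u v w

/-- The norm `‖B‖_{VV*} = sup_{v, z ∈ V₀} B(v, z) / (‖v‖_{H²} ‖z‖_{H²})`, with values in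
`[0, ∞]`. -/
def vvNorm (B : L2 Ω → L2 Ω → ℝ) : ℝ≥0∞ :=
  ⨆ v ∈ V0 Ω, ⨆ z ∈ V0 Ω, ENNReal.ofReal (B v z / (hNorm Ω 2 v * hNorm Ω 2 z))

/-- The variational equation
`ε (Δu, Δv) + (F(D²u, ∇u, u, x), v) = ⟨ε², ∂v/∂ν⟩_{∂Ω}` tested with `v`. -/
def MomentEq (ε : ℝ) (u v : L2 Ω) : Prop :=
  Integrable (fun x => opF Ω F u x * v x) (volume.restrict Ω) ∧
    ε * inner ℝ (lap Ω u) (lap Ω v) + pairF Ω F u v =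
      ∫ x, ε ^ 2 * normalDeriv Ω v x ∂(surf Ω)

/-- `u ∈ V_g` is a (weak) solution of the vanishing moment problem
`ε Δ²u + F(D²u, ∇u, u, x) = 0` in `Ω`, `u = g` and `Δu = ε` on `∂Ω`. -/
def IsMomentSolution (g : E n → ℝ) (ε : ℝ) (u : L2 Ω) : Prop :=
  u ∈ Vg Ω g ∧ ∀ v ∈ V0 Ω, MomentEq Ω F ε u v

end Equation

section FiniteElements

variable {n : ℕ}

/-- A nondegenerate closed simplex. -/
def IsSimplex (K : Set (E n)) : Prop :=
  ∃ p : Fin (n + 1) → E n, AffineIndependent ℝ p ∧ K = convexHull ℝ (range p)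

/-- A nondegenerate closed rectangle (box). -/
def IsBox (K : Set (E n)) : Prop :=
  ∃ a b : E n, (∀ i, a i < b i) ∧ K = {x | ∀ i, x i ∈ Icc (a i) (b i)}

/-- `T` is a partition of `Ω` into simplices or rectangles of size `h`; with a constant `q` that
does not depend on `h` this is quasiuniformity. -/
def IsMesh (Ω : Set (E n)) (q h : ℝ) (T : Finset (Set (E n))) : Prop :=
  (∀ K ∈ T, (IsSimplex K ∨ IsBox K) ∧ Metric.diam K ≤ h ∧ ∃ x, Metric.ball x (q * h) ⊆ K) ∧
  (∀ K ∈ T, ∀ K' ∈ T, K ≠ K' → Disjoint (interior K) (interior K')) ∧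
  (⋃ K ∈ T, K) = closure Ω

/-- On the element `K`, `f` is a polynomial of degree at most `k` (in each variable, if `K` is
a rectangle). -/
def IsPolyOn (Ω : Set (E n)) (k : ℕ) (K : Set (E n)) (f : L2 Ω) : Prop :=
  ∃ P : MvPolynomial (Fin n) ℝ,
    (P.totalDegree ≤ k ∨ (IsBox K ∧ ∀ i, P.degreeOf i ≤ k)) ∧
    ∀ᵐ x ∂((volume : Measure (E n)).restrict (K ∩ Ω)), f x = MvPolynomial.eval (fun i => x i) P

/-- A family of `H²`-conforming (`C¹`) finite element spaces of degree `k` on quasiuniform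
partitions of `Ω`, together with their interpolation operators, which map `V₀` to `V₀ ∩ V^h`. -/
structure ConformingFE (Ω : Set (E n)) (k : ℕ) where
  /-- the set of mesh sizes -/
  sizes : Set ℝ
  sizes_pos : ∀ h ∈ sizes, 0 < h
  /-- the quasiuniformity constant -/
  q : ℝ
  q_pos : 0 < q
  /-- the partitions -/
  mesh : ℝ → Finset (Set (E n))
  isMesh : ∀ h ∈ sizes, IsMesh Ω q h (mesh h)
  /-- the finite element spaces `V^h ⊂ V` -/
  Vh : ℝ → Submodule ℝ (L2 Ω)
  conforming : ∀ h ∈ sizes, Vh h ≤ H Ω 2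
  piecewise_poly : ∀ h ∈ sizes, ∀ v ∈ Vh h, ∀ K ∈ mesh h, IsPolyOn Ω k K v
  /-- the interpolation operators `I_h : V → V^h` -/
  interp : ℝ → L2 Ω → L2 Ω
  interp_mem : ∀ h ∈ sizes, ∀ v ∈ H Ω 2, interp h v ∈ Vh h
  interp_mem_V0 : ∀ h ∈ sizes, ∀ v ∈ V0 Ω, interp h v ∈ V0 Ω

variable {Ω : Set (E n)} {k : ℕ} (S : ConformingFE Ω k)

/-- `V^h_g = {v_h ∈ V^h : v_h = g on ∂Ω}`. -/
def ConformingFE.Vhg (g : E n → ℝ) (h : ℝ) : Set (L2 Ω) := {v | v ∈ S.Vh h ∧ HasTrace Ω v g}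

/-- `V^h_0 = {v_h ∈ V^h : v_h = 0 on ∂Ω}`. -/
def ConformingFE.Vh0 (h : ℝ) : Set (L2 Ω) := S.Vhg 0 h

/-- The approximation property of order `σ`: with `ℓ = min{σ, k+1}`,
`‖v - I_h v‖_{H^j} ≤ C h^{ℓ-j} ‖v‖_{H^ℓ}` for `v ∈ V ∩ H^σ(Ω)` and `j = 0, 1, 2`. -/
def ConformingFE.Approximates (σ : ℝ) : Prop :=
  ∃ C > 0, ∀ h ∈ S.sizes, ∀ v ∈ H Ω 2, MemHs Ω σ v → ∀ j ≤ 2,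
    hNorm Ω j (v - S.interp h v) ≤
      C * h ^ (min σ ((k : ℝ) + 1) - (j : ℝ)) * hsNorm Ω (min σ ((k : ℝ) + 1)) v

/-- `u_h ∈ V^h_g` solves the finite element method. -/
def ConformingFE.IsFEMSolution (F : (Fin n → Fin n → ℝ) → E n → ℝ → E n → ℝ) (g : E n → ℝ)
    (ε h : ℝ) (uh : L2 Ω) : Prop :=
  uh ∈ S.Vhg g h ∧ ∀ v ∈ S.Vh0 h, MomentEq Ω F ε uh v

end FiniteElements

section Assumptions

variable {n : ℕ} {Ω : Set (E n)} (F : (Fin n → Fin n → ℝ) → E n → ℝ → E n → ℝ) (g : E n → ℝ)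
  (ε₀ s p : ℝ) (u : ℝ → L2 Ω) (C₀ C₁ C₂ CR δ : ℝ → ℝ) (L : ℝ → ℝ → ℝ)
  (Y : Submodule ℝ (L2 Ω)) (N : L2 Ω → ℝ) {k : ℕ} (S : ConformingFE Ω k)

/-- `N` is a norm on the linear space `Y`. (Definiteness and completeness are not needed.) -/
def IsNormOn : Prop :=
  (∀ x ∈ Y, ∀ y ∈ Y, N (x + y) ≤ N x + N y) ∧ ∀ (a : ℝ), ∀ x ∈ Y, N (a • x) = |a| * N x

/-- The operator `w ↦ F(w)` is well defined on `Y ∩ V_g` with values in the functionals on `V₀`,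
and `F'` is its (Gâteaux) derivative there; the pairings `⟨F'[y](v), z⟩` that enter
`‖F'[y]‖_{VV*}` are well defined for `y ∈ Y`. -/
def IsDerivativeOn : Prop :=
  (∀ y ∈ Y, ∀ v ∈ V0 Ω, ∀ z ∈ V0 Ω,
    Integrable (fun x => opF' Ω F y v x * z x) (volume.restrict Ω)) ∧
  (∀ w ∈ Y, w ∈ Vg Ω g → ∀ z ∈ V0 Ω,
    Integrable (fun x => opF Ω F w x * z x) (volume.restrict Ω)) ∧
  (∀ w ∈ Y, w ∈ Vg Ω g → ∀ v ∈ Y, v ∈ V0 Ω → ∀ z ∈ V0 Ω,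
    HasDerivAt (fun t : ℝ => pairF Ω F (w + t • v) z) (pairF' Ω F w v z) 0)

/-- [A1] For `ε ∈ (0, ε₀]`, `u ε ∈ H^s(Ω)`, `s ≥ 3`, is a locally unique solution of the
vanishing moment problem. -/
def A1 : Prop :=
  0 < ε₀ ∧ ε₀ < 1 ∧ 3 ≤ s ∧ ∀ ε ∈ Ioc 0 ε₀,
    MemHs Ω s (u ε) ∧ IsMomentSolution Ω F g ε (u ε) ∧
    ∃ ρ > 0, ∀ v, IsMomentSolution Ω F g ε v → hNorm Ω 2 (v - u ε) ≤ ρ → v = u ε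

/-- [A2] `(G_ε'[u^ε])^* : V₀ → V₀^*` is an isomorphism; Gårding's inequality with constants
`C₁`, `C₀`; the bound `‖F'[u^ε]‖_{VV*} ≤ C₂`; `H^p` regularity of the adjoint problem with the
constant `C_R`. -/
def A2 : Prop :=
  2 < p ∧ ∀ ε ∈ Ioc 0 ε₀,
    0 ≤ C₀ ε ∧ 0 < C₁ ε ∧ 0 < C₂ ε ∧ 0 < CR ε ∧
    (∀ φ : V0 Ω →ₗ[ℝ] ℝ, (∃ M : ℝ, ∀ w, |φ w| ≤ M * hNorm Ω 2 (w : L2 Ω)) →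
      ∃! v : V0 Ω, ∀ w : V0 Ω, pairG' Ω F ε (u ε) w v = φ w) ∧
    (∀ v ∈ V0 Ω, C₁ ε * hNorm Ω 2 v ^ 2 - C₀ ε * ‖v‖ ^ 2 ≤ pairG' Ω F ε (u ε) v v) ∧
    vvNorm Ω (pairF' Ω F (u ε)) ≤ ENNReal.ofReal (C₂ ε) ∧
    (∀ φ : L2 Ω, ∀ v ∈ V0 Ω, (∀ w ∈ V0 Ω, pairG' Ω F ε (u ε) w v = inner ℝ φ w) →
      MemHs Ω p v ∧ hsNorm Ω p v ≤ CR ε * ‖φ‖)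

/-- [A3] `sup_{y ∈ Y} ‖F'[y]‖_{VV*} / ‖y‖_Y ≤ C`; the norm of `Y` is defined on `V^h`
(and on `u^ε`). -/
def A3 : Prop :=
  Y ≤ H Ω 2 ∧ IsNormOn Y N ∧ (∀ h ∈ S.sizes, S.Vh h ≤ Y) ∧ (∀ ε ∈ Ioc 0 ε₀, u ε ∈ Y) ∧
  ∃ C > 0, ∀ y ∈ Y, vvNorm Ω (pairF' Ω F y) ≤ ENNReal.ofReal (C * N y)

/-- [A4] `‖I_h u^ε‖_Y ≤ C ‖u^ε‖_Y`, `C` independent of `ε` (and `h`). -/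
def A4 : Prop :=
  ∃ C > 0, ∀ ε ∈ Ioc 0 ε₀, ∀ h ∈ S.sizes, N (S.interp h (u ε)) ≤ C * N (u ε)

/-- [A5] `‖F'[u^ε] - F'[w_h]‖_{VV*} ≤ L(h) ‖u^ε - w_h‖_{H²}` for all `w_h ∈ V^h_g` with
`‖I_h u^ε - w_h‖_{H²} ≤ δ`, where `δ ∈ (0,1)` does not depend on `h`, and `L(h) = o(h^{2-ℓ})`. -/
def A5 : Prop :=
  ∀ ε ∈ Ioc 0 ε₀, 0 < δ ε ∧ δ ε < 1 ∧ (∀ h ∈ S.sizes, 0 ≤ L ε h) ∧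
    (∀ h ∈ S.sizes, ∀ w ∈ S.Vhg g h, hNorm Ω 2 (S.interp h (u ε) - w) ≤ δ ε →
      vvNorm Ω (fun v z => pairF' Ω F (u ε) v z - pairF' Ω F w v z) ≤
        ENNReal.ofReal (L ε h * hNorm Ω 2 (u ε - w))) ∧
    (fun h => L ε h) =o[𝓝[S.sizes] 0] (fun h => h ^ (2 - min s ((k : ℝ) + 1)))

/-- The Lipschitz bound of [A5] at the points `y = u^ε + γ (w_h - u^ε)`, `γ ∈ [0,1]`, of the
segments that join `u^ε` to the functions `w_h` of [A5]. -/
def LipschitzOnSegments (ε h : ℝ) : Prop :=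
  ∀ w ∈ S.Vhg g h, hNorm Ω 2 (S.interp h (u ε) - w) ≤ δ ε → ∀ γ ∈ Icc (0 : ℝ) 1,
    vvNorm Ω (fun v z => pairF' Ω F (u ε) v z - pairF' Ω F (u ε + γ • (w - u ε)) v z) ≤
      ENNReal.ofReal (L ε h * hNorm Ω 2 (γ • (w - u ε)))

end Assumptions

/-- `M = max{C₁^{-1/2}, C₀^{1/2} C_R}`. -/
def cM (C₀ C₁ CR : ℝ) : ℝ := max (C₁ ^ (-(1 / 2) : ℝ)) (C₀ ^ (1 / 2 : ℝ) * CR)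

/-- `K = C₁^{-1/2} ‖u‖_Y max{C₁^{-1/2}, C₀^{1/2} C_R}`; the error constant of the `H²` estimate
is a generic multiple of `K`. -/
def cK (C₀ C₁ CR NuY : ℝ) : ℝ := C₁ ^ (-(1 / 2) : ℝ) * NuY * cM C₀ C₁ CR

open Classical in
/-- `h₀ = c (C₀ C₁⁻¹ C₂² C_R²)^{1/(4-2r)}` if `C₀ ≠ 0`, and `h₀ = 1` if `C₀ = 0`. -/
def h0 (c C₀ C₁ C₂ CR r : ℝ) : ℝ :=
  if C₀ = 0 then 1 else c * (C₀ * C₁⁻¹ * C₂ ^ 2 * CR ^ 2) ^ (1 / (4 - 2 * r))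

end VMM

end

open VMM

/-! The method is solved by a quasi-Newton iteration around the interpolant `ũ`, with the
linearization frozen at the exact solution. Write A for G_ε'[u^ε] restricted to V^h_0, and R(x) for
the residual of ũ + x minus that of u^ε; the boundary term cancels, and the discrete solutions are ũ
+ x with R(x) = 0. The map x ↦ x - A⁻¹R(x) is a contraction of a small ball
(`exists_unique_zero_of_contraction`), given three facts.

Stability of A: G_ε'[u^ε] satisfies only a Gårding inequality, so Schatz' argument is used. The L²
norm of a discrete v is bounded through the adjoint problem with datum v and the interpolant of its
solution. For h ≤ h₀ the resulting multiple of the H² norm is absorbed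
(`exists_discrete_stability`). The inverse has norm of order C₁^{-1/2} M.

Consistency of ũ: by the mean value theorem R(0) is F' at a point between u^ε and ũ, applied to the
interpolation error. Such a point is not discrete, so only the bounds in Y are available; this
produces the factor ‖u^ε‖_Y (`abs_residual_le`). Multiplied by the stability constant it gives K.

Small linearization error: two points of the discrete ball are joined by a segment of discrete
functions, so [A5] bounds F' at the mean value point (`abs_linearization_error_le`).

The H² estimate is then the triangle inequality. For L², the adjoint problem is solved with the
error as datum. Splitting its solution into interpolation error and interpolant gives a term bounded
by continuity, and a term that is a pure linearization error, because the discrete equation holds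
for the interpolant (`norm_sub_le_of_dual`). The segment from u^ε to u_h^ε is not discrete, whence
the Lipschitz bound on segments. -/

namespace VMM

/-! ### Weak derivatives and Sobolev norms -/

section SobolevCalculus

variable {n : ℕ} {Ω : Set (E n)}

/-- Weak derivatives are unique. -/
lemma IsWeakDeriv.unique (hΩ : IsOpen Ω) {m : ℕ} {α : Fin m → Fin n} {f g g' : L2 Ω}
    (h : IsWeakDeriv Ω α f g) (h' : IsWeakDeriv Ω α f g') : g = g' := by
  have hint : ∀ φ : E n → ℝ, ContDiff ℝ ∞ φ → HasCompactSupport φ → tsupport φ ⊆ Ω →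
      ∫ x in Ω, φ x • (g - g' : L2 Ω) x = 0 := by
    intro φ hφ hc hs
    have e1 : ∫ x in Ω, φ x • (g - g' : L2 Ω) x =
        (∫ x in Ω, g x * φ x) - ∫ x in Ω, g' x * φ x := by
      rw [← integral_sub (integrable_mul_test Ω g hφ.continuous hc)
        (integrable_mul_test Ω g' hφ.continuous hc)]
      refine integral_congr_ae ?_
      filter_upwards [Lp.coeFn_sub g g'] with x hx
      rw [hx, Pi.sub_apply, smul_eq_mul]
      ring
    have e2 := (h φ hφ hc hs).symm.trans (h' φ hφ hc hs)
    rw [e1, mul_left_cancel₀ (pow_ne_zero m (by norm_num : (-1 : ℝ) ≠ 0)) e2, sub_self]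
  -- Fundamental lemma of the calculus of variations.
  have h0 := hΩ.ae_eq_zero_of_integral_contDiff_smul_eq_zero
    (((Lp.memLp (g - g')).locallyIntegrable (by norm_num)).locallyIntegrableOn Ω) hint
  have h1 : g - g' = 0 := by
    rw [Lp.eq_zero_iff_ae_eq_zero]
    filter_upwards [h0, ae_restrict_mem hΩ.measurableSet] with x hx hxΩ using hx hxΩ
  exact sub_eq_zero.mp h1

lemma IsWeakDeriv.wD_eq (hΩ : IsOpen Ω) {m : ℕ} {α : Fin m → Fin n} {f g : L2 Ω}
    (h : IsWeakDeriv Ω α f g) : wD Ω α f = g := by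
  have hex : ∃ g, IsWeakDeriv Ω α f g := ⟨g, h⟩
  rw [wD, dif_pos hex]
  exact hex.choose_spec.unique hΩ h

lemma isWeakDeriv_wD {m j : ℕ} (hj : j ≤ m) (α : Fin j → Fin n) {f : L2 Ω} (hf : f ∈ H Ω m) :
    IsWeakDeriv Ω α f (wD Ω α f) := by
  have hex := hf j hj α
  rw [wD, dif_pos hex]
  exact hex.choose_spec

lemma wD_add (hΩ : IsOpen Ω) {m j : ℕ} (hj : j ≤ m) (α : Fin j → Fin n) {f f' : L2 Ω}
    (hf : f ∈ H Ω m) (hf' : f' ∈ H Ω m) : wD Ω α (f + f') = wD Ω α f + wD Ω α f' :=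
  ((isWeakDeriv_wD hj α hf).add (isWeakDeriv_wD hj α hf')).wD_eq hΩ

lemma wD_smul (hΩ : IsOpen Ω) {m j : ℕ} (hj : j ≤ m) (α : Fin j → Fin n) {f : L2 Ω} (c : ℝ)
    (hf : f ∈ H Ω m) : wD Ω α (c • f) = c • wD Ω α f :=
  ((isWeakDeriv_wD hj α hf).smul c).wD_eq hΩ

lemma wD_of_order_zero (hΩ : IsOpen Ω) (α : Fin 0 → Fin n) (f : L2 Ω) : wD Ω α f = f := by
  refine IsWeakDeriv.wD_eq hΩ fun φ _ _ _ => ?_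
  simp

variable (Ω) in
/-- The vector of all weak derivatives of order at most `m`. -/
noncomputable def jet (m : ℕ) (f : L2 Ω) :
    PiLp 2 (fun _ : (Σ j : Fin (m + 1), (Fin (j : ℕ) → Fin n)) => L2 Ω) :=
  WithLp.toLp 2 fun a => wD Ω a.2 f

/-- Both are the ℓ² sum of the same L² norms. Since `jet` is linear on `H Ω m`, the norm axioms for
`hNorm` are inherited from the product space. -/
lemma norm_jet (m : ℕ) (f : L2 Ω) : ‖jet Ω m f‖ = hNorm Ω m f := by
  rw [PiLp.norm_eq_of_L2, hNorm, Fintype.sum_sigma, ← Fin.sum_univ_eq_sum_range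
    (fun j => ∑ α : Fin j → Fin n, ‖wD Ω α f‖ ^ 2)]
  rfl

lemma jet_add (hΩ : IsOpen Ω) {m : ℕ} {f f' : L2 Ω} (hf : f ∈ H Ω m) (hf' : f' ∈ H Ω m) :
    jet Ω m (f + f') = jet Ω m f + jet Ω m f' := by
  ext1 a
  exact wD_add hΩ (Nat.lt_succ_iff.mp a.1.2) a.2 hf hf'

lemma jet_smul (hΩ : IsOpen Ω) {m : ℕ} {f : L2 Ω} (c : ℝ) (hf : f ∈ H Ω m) :
    jet Ω m (c • f) = c • jet Ω m f := by
  ext1 a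
  exact wD_smul hΩ (Nat.lt_succ_iff.mp a.1.2) a.2 c hf

lemma hNorm_nonneg (m : ℕ) (f : L2 Ω) : 0 ≤ hNorm Ω m f := Real.sqrt_nonneg _

lemma hNorm_add_le (hΩ : IsOpen Ω) {m : ℕ} {f f' : L2 Ω} (hf : f ∈ H Ω m) (hf' : f' ∈ H Ω m) :
    hNorm Ω m (f + f') ≤ hNorm Ω m f + hNorm Ω m f' := by
  simp only [← norm_jet]
  rw [jet_add hΩ hf hf']
  exact norm_add_le _ _

lemma hNorm_smul (hΩ : IsOpen Ω) {m : ℕ} {f : L2 Ω} (c : ℝ) (hf : f ∈ H Ω m) :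
    hNorm Ω m (c • f) = |c| * hNorm Ω m f := by
  simp only [← norm_jet]
  rw [jet_smul hΩ c hf, norm_smul, Real.norm_eq_abs]

lemma hNorm_neg (hΩ : IsOpen Ω) {m : ℕ} {f : L2 Ω} (hf : f ∈ H Ω m) :
    hNorm Ω m (-f) = hNorm Ω m f := by
  have := hNorm_smul hΩ (-1) hf
  simpa using this

lemma hNorm_sub_comm (hΩ : IsOpen Ω) {m : ℕ} {f f' : L2 Ω} (hf : f ∈ H Ω m) (hf' : f' ∈ H Ω m) :
    hNorm Ω m (f - f') = hNorm Ω m (f' - f) := by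
  rw [← neg_sub, hNorm_neg hΩ (sub_mem hf' hf)]

lemma hNorm_sub_le (hΩ : IsOpen Ω) {m : ℕ} {f f' : L2 Ω} (hf : f ∈ H Ω m) (hf' : f' ∈ H Ω m) :
    hNorm Ω m (f - f') ≤ hNorm Ω m f + hNorm Ω m f' := by
  rw [sub_eq_add_neg, ← hNorm_neg hΩ hf']
  exact hNorm_add_le hΩ hf (neg_mem hf')

lemma hNorm_mono {m m' : ℕ} (hm : m ≤ m') (f : L2 Ω) : hNorm Ω m f ≤ hNorm Ω m' f := by
  refine Real.sqrt_le_sqrt (Finset.sum_le_sum_of_subset_of_nonneg ?_ fun _ _ _ => ?_)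
  · exact Finset.range_mono (by omega)
  · positivity

lemma norm_wD_le_hNorm {m j : ℕ} (hj : j ≤ m) (α : Fin j → Fin n) (f : L2 Ω) :
    ‖wD Ω α f‖ ≤ hNorm Ω m f := by
  rw [← norm_jet]
  exact PiLp.norm_apply_le (jet Ω m f) ⟨⟨j, Nat.lt_succ_iff.mpr hj⟩, α⟩

lemma norm_le_hNorm (hΩ : IsOpen Ω) (m : ℕ) (f : L2 Ω) : ‖f‖ ≤ hNorm Ω m f := by
  have := norm_wD_le_hNorm (Nat.zero_le m) (Fin.elim0 : Fin 0 → Fin n) f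
  rwa [wD_of_order_zero hΩ] at this

lemma eq_zero_of_hNorm_le_zero (hΩ : IsOpen Ω) {m : ℕ} {f : L2 Ω} (h : hNorm Ω m f ≤ 0) :
    f = 0 :=
  norm_le_zero_iff.mp ((norm_le_hNorm hΩ m f).trans h)

lemma hNorm_zero (hΩ : IsOpen Ω) (m : ℕ) : hNorm Ω m 0 = 0 := by
  simpa using hNorm_smul hΩ (m := m) 0 (zero_mem (H Ω m))

lemma lap_add (hΩ : IsOpen Ω) {f f' : L2 Ω} (hf : f ∈ H Ω 2) (hf' : f' ∈ H Ω 2) :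
    lap Ω (f + f') = lap Ω f + lap Ω f' := by
  simp only [lap, wD_add hΩ le_rfl _ hf hf', Finset.sum_add_distrib]

lemma lap_smul (hΩ : IsOpen Ω) {f : L2 Ω} (c : ℝ) (hf : f ∈ H Ω 2) :
    lap Ω (c • f) = c • lap Ω f := by
  simp only [lap, wD_smul hΩ le_rfl _ c hf, Finset.smul_sum]

lemma lap_sub (hΩ : IsOpen Ω) {f f' : L2 Ω} (hf : f ∈ H Ω 2) (hf' : f' ∈ H Ω 2) :
    lap Ω (f - f') = lap Ω f - lap Ω f' := by
  rw [eq_sub_iff_add_eq, ← lap_add hΩ (sub_mem hf hf') hf', sub_add_cancel]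

lemma norm_lap_le (f : L2 Ω) : ‖lap Ω f‖ ≤ n * hNorm Ω 2 f := by
  refine (norm_sum_le _ _).trans ((Finset.sum_le_sum fun i _ =>
    norm_wD_le_hNorm le_rfl ![i, i] f).trans_eq ?_)
  simp

lemma hsNorm_nonneg (s : ℝ) (f : L2 Ω) : 0 ≤ hsNorm Ω s f := Real.sqrt_nonneg _

lemma hNorm_floor_le_hsNorm (s : ℝ) (f : L2 Ω) : hNorm Ω ⌊s⌋₊ f ≤ hsNorm Ω s f := by
  refine Real.le_sqrt_of_sq_le ?_
  split_ifs
  · simp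
  · exact le_add_of_nonneg_right (Finset.sum_nonneg fun _ _ => ENNReal.toReal_nonneg)

lemma hNorm_le_hsNorm {m : ℕ} {s : ℝ} (hm : (m : ℝ) ≤ s) (f : L2 Ω) :
    hNorm Ω m f ≤ hsNorm Ω s f :=
  (hNorm_mono (Nat.le_floor hm) f).trans (hNorm_floor_le_hsNorm s f)

lemma hsNorm_natCast (m : ℕ) (f : L2 Ω) : hsNorm Ω (m : ℝ) f = hNorm Ω m f := by
  simp [hsNorm, hNorm_nonneg]

/-- No comparison between fractional orders is needed: the minimum is either s itself or an integer,
and integer norms are dominated termwise. -/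
lemma hsNorm_min_natCast_le (s : ℝ) (m : ℕ) (f : L2 Ω) :
    hsNorm Ω (min s (m : ℝ)) f ≤ hsNorm Ω s f := by
  rcases le_total s (m : ℝ) with h | h
  · rw [min_eq_left h]
  · rw [min_eq_right h, hsNorm_natCast]
    exact hNorm_le_hsNorm h f

end SobolevCalculus

/-! ### Affine structure of V_g over V₀ -/

section BoundaryValues

variable {n : ℕ} {Ω : Set (E n)} {g : E n → ℝ}

lemma HasTrace.sub {f f' : L2 Ω} (h : HasTrace Ω f g) (h' : HasTrace Ω f' g) :
    HasTrace Ω (f - f') 0 := by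
  have := h.add (h'.smul (-1))
  simpa [sub_eq_add_neg] using this

lemma HasTrace.add_zero {f v : L2 Ω} (h : HasTrace Ω f g) (h' : HasTrace Ω v 0) :
    HasTrace Ω (f + v) g := by
  simpa using h.add h'

lemma Vg_sub {f f' : L2 Ω} (hf : f ∈ Vg Ω g) (hf' : f' ∈ Vg Ω g) : f - f' ∈ V0 Ω :=
  ⟨sub_mem hf.1 hf'.1, hf.2.sub hf'.2⟩

lemma Vg_add {f v : L2 Ω} (hf : f ∈ Vg Ω g) (hv : v ∈ V0 Ω) : f + v ∈ Vg Ω g :=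
  ⟨add_mem hf.1 hv.1, hf.2.add_zero hv.2⟩

end BoundaryValues

/-! ### Finite element spaces: dimension and mesh sizes -/

section FiniteElementSpaces

variable {n : ℕ} {Ω : Set (E n)} {k : ℕ} (S : ConformingFE Ω k) {h : ℝ}

/-- `V^h_0` as a linear subspace. -/
noncomputable def ConformingFE.V0h (h : ℝ) : Submodule ℝ (L2 Ω) where
  carrier := S.Vh0 h
  add_mem' := fun ha hb => ⟨add_mem ha.1 hb.1, ha.2.add_zero hb.2⟩
  zero_mem' := ⟨zero_mem _, HasTrace.zero⟩
  smul_mem' := fun c f hf => ⟨Submodule.smul_mem _ c hf.1, by simpa using hf.2.smul c⟩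

variable {S}

lemma ConformingFE.V0h_le (hh : h ∈ S.sizes) : S.V0h h ≤ V0 Ω :=
  fun _ hv => ⟨S.conforming h hh hv.1, hv.2⟩

lemma ConformingFE.Vhg_subset {g : E n → ℝ} (hh : h ∈ S.sizes) : S.Vhg g h ⊆ Vg Ω g :=
  fun _ hv => ⟨S.conforming h hh hv.1, hv.2⟩

lemma ConformingFE.Vhg_add {g : E n → ℝ} {f v : L2 Ω} (hf : f ∈ S.Vhg g h) (hv : v ∈ S.V0h h) :
    f + v ∈ S.Vhg g h :=
  ⟨add_mem hf.1 hv.1, hf.2.add_zero hv.2⟩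

lemma ConformingFE.Vhg_sub {g : E n → ℝ} {f f' : L2 Ω} (hf : f ∈ S.Vhg g h)
    (hf' : f' ∈ S.Vhg g h) : f - f' ∈ S.V0h h :=
  ⟨sub_mem hf.1 hf'.1, hf.2.sub hf'.2⟩

lemma ConformingFE.interp_mem_V0h (hh : h ∈ S.sizes) {v : L2 Ω} (hv : v ∈ V0 Ω) :
    S.interp h v ∈ S.V0h h :=
  ⟨S.interp_mem h hh v hv.1, (S.interp_mem_V0 h hh v hv).2⟩

/-- Finite element spaces are finite dimensional. -/
lemma ConformingFE.finiteDimensional_Vh (hh : h ∈ S.sizes) :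
    FiniteDimensional ℝ (S.Vh h) := by
  classical
  -- Total degree at most k forces degree at most k in each variable, so simplices and boxes share
  -- one finite dimensional polynomial space.
  have hpoly : ∀ v : S.Vh h, ∀ K : S.mesh h, ∃ P ∈ MvPolynomial.restrictDegree (Fin n) ℝ k,
      ∀ᵐ x ∂((volume : Measure (E n)).restrict (K ∩ Ω)),
        (v : L2 Ω) x = MvPolynomial.eval (fun i => x i) P := by
    intro v K
    obtain ⟨P, hP, hv⟩ := S.piecewise_poly h hh v v.2 K K.2
    refine ⟨P, ?_, hv⟩
    rcases hP with hP | ⟨-, hP⟩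
    · exact MvPolynomial.restrictTotalDegree_le_restrictDegree _ _ k
        ((MvPolynomial.mem_restrictTotalDegree _ _ _).mpr hP)
    · rw [MvPolynomial.mem_restrictDegree]
      exact fun s hs i => (MvPolynomial.monomial_le_degreeOf i hs).trans (hP i)
  -- The graph of the relation "v equals P_K on every K". Working with the relation avoids choosing
  -- the polynomials linearly in v: W embeds into the polynomials because the elements cover Ω, and
  -- it maps onto V^h.
  let W : Submodule ℝ (S.Vh h × (S.mesh h → MvPolynomial.restrictDegree (Fin n) ℝ k)) :=
    { carrier := {w | ∀ K : S.mesh h, ∀ᵐ x ∂((volume : Measure (E n)).restrict (K ∩ Ω)),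
        (w.1 : L2 Ω) x = MvPolynomial.eval (fun i => x i) (w.2 K : MvPolynomial (Fin n) ℝ)}
      add_mem' := by
        intro a b ha hb K
        have hab := ae_restrict_of_ae_restrict_of_subset
          (inter_subset_right (s := (K : Set (E n))) (t := Ω))
          (Lp.coeFn_add (a.1 : L2 Ω) (b.1 : L2 Ω))
        filter_upwards [ha K, hb K, hab] with x h1 h2 h3
        simp only [Prod.fst_add, Submodule.coe_add, Prod.snd_add, Pi.add_apply, map_add] at h3 ⊢
        rw [h3, h1, h2]
      zero_mem' := by
        intro K
        have h0 := ae_restrict_of_ae_restrict_of_subset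
          (inter_subset_right (s := (K : Set (E n))) (t := Ω))
          (Lp.coeFn_zero ℝ 2 ((volume : Measure (E n)).restrict Ω))
        filter_upwards [h0] with x h3
        simpa using h3
      smul_mem' := by
        intro c a ha K
        have hab := ae_restrict_of_ae_restrict_of_subset
          (inter_subset_right (s := (K : Set (E n))) (t := Ω)) (Lp.coeFn_smul c (a.1 : L2 Ω))
        filter_upwards [ha K, hab] with x h1 h3
        simp only [Prod.smul_fst, Submodule.coe_smul, Prod.smul_snd, Pi.smul_apply,
          MvPolynomial.smul_eval, smul_eq_mul] at h3 ⊢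
        rw [h3, h1] }
  have hcover : Ω ⊆ ⋃ K : S.mesh h, ((K : Set (E n)) ∩ Ω) := by
    intro x hx
    have hx' : x ∈ ⋃ K ∈ S.mesh h, K := by
      rw [(S.isMesh h hh).2.2]
      exact subset_closure hx
    simp only [mem_iUnion, exists_prop] at hx'
    obtain ⟨K, hK, hxK⟩ := hx'
    exact mem_iUnion.mpr ⟨⟨K, hK⟩, hxK, hx⟩
  let snd : W →ₗ[ℝ] (S.mesh h → MvPolynomial.restrictDegree (Fin n) ℝ k) :=
    (LinearMap.snd ℝ _ _).comp W.subtype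
  let fst : W →ₗ[ℝ] S.Vh h := (LinearMap.fst ℝ _ _).comp W.subtype
  have hinj : Function.Injective snd := by
    rw [injective_iff_map_eq_zero]
    rintro ⟨⟨v, P⟩, hw⟩ h0
    have hP : P = 0 := h0
    subst hP
    have hv : (v : L2 Ω) = 0 := by
      rw [Lp.eq_zero_iff_ae_eq_zero]
      refine ae_restrict_of_ae_restrict_of_subset hcover ?_
      refine (ae_restrict_iUnion_iff _ _).mpr fun K => ?_
      filter_upwards [hw K] with x hx
      simpa using hx
    have hv' : v = 0 := Subtype.ext hv
    subst hv'
    rfl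
  have hsurj : Function.Surjective fst := by
    intro v
    choose P hP hv using hpoly v
    exact ⟨⟨⟨v, fun K => ⟨P K, hP K⟩⟩, hv⟩, rfl⟩
  have : FiniteDimensional ℝ W := FiniteDimensional.of_injective snd hinj
  exact Module.Finite.of_surjective fst hsurj

lemma ConformingFE.finiteDimensional_V0h (hh : h ∈ S.sizes) :
    FiniteDimensional ℝ (S.V0h h) :=
  have := finiteDimensional_Vh hh
  Submodule.finiteDimensional_of_le (fun _ hv => hv.1 : S.V0h h ≤ S.Vh h)

/-- The mesh sizes are bounded. -/
lemma ConformingFE.exists_size_bound (S : ConformingFE Ω k) (hn : 1 ≤ n)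
    (hb : Bornology.IsBounded Ω) (hne : Ω.Nonempty) :
    ∃ B : ℝ, 0 < B ∧ ∀ h ∈ S.sizes, h ≤ B := by
  obtain ⟨R, hR⟩ := hb.closure.subset_closedBall 0
  -- An element contains a ball of radius q h and lies in a ball of radius R; the diameters are
  -- compared.
  refine ⟨max 1 (R / S.q), by positivity, fun h hh => le_max_of_le_right ?_⟩
  obtain ⟨y, hy⟩ := hne
  have hy' : y ∈ ⋃ K ∈ S.mesh h, K := by
    rw [(S.isMesh h hh).2.2]
    exact subset_closure hy
  simp only [mem_iUnion, exists_prop] at hy'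
  obtain ⟨K, hK, -⟩ := hy'
  obtain ⟨-, -, x, hx⟩ := (S.isMesh h hh).1 K hK
  have hKR : Metric.ball x (S.q * h) ⊆ Metric.closedBall 0 R := by
    refine hx.trans (Subset.trans ?_ hR)
    rw [← (S.isMesh h hh).2.2]
    exact subset_biUnion_of_mem (u := fun K => K) hK
  have hpos : 0 < S.q * h := mul_pos S.q_pos (S.sizes_pos h hh)
  -- In dimension zero a ball would have diameter 0 instead of twice its radius.
  have : Nonempty (Fin n) := ⟨⟨0, hn⟩⟩
  have hd := Metric.diam_mono hKR Metric.isBounded_closedBall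
  rw [Metric.diam_ball_eq x hpos.le] at hd
  have hR0 : 0 ≤ R := by
    have := hKR (Metric.mem_ball_self hpos)
    rw [Metric.mem_closedBall] at this
    exact dist_nonneg.trans this
  have := hd.trans (Metric.diam_closedBall hR0)
  rw [le_div_iff₀ S.q_pos]
  linarith

end FiniteElementSpaces

/-! ### The contraction argument -/

section Abstract

/-- Quasi-Newton iteration: zeros of a nonlinear residual `R` that is close to a boundedly
invertible bilinear form `A` on a finite dimensional space. -/
lemma exists_unique_zero_of_contraction {X : Type*} [AddCommGroup X] [Module ℝ X]
    [FiniteDimensional ℝ X] (q : X → ℝ) (q_add : ∀ x y, q (x + y) ≤ q x + q y)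
    (q_smul : ∀ (c : ℝ) x, q (c • x) = |c| * q x) (q_def : ∀ x, q x ≤ 0 → x = 0)
    (A : X →ₗ[ℝ] X →ₗ[ℝ] ℝ) (R : X → X →ₗ[ℝ] ℝ) {β Φ lam a ρ : ℝ}
    (hΦ : 0 ≤ Φ) (hlam : 0 ≤ lam)
    (hA : ∀ v Ψ, 0 ≤ Ψ → (∀ w, A v w ≤ Ψ * q w) → q v ≤ β * Ψ)
    (hR0 : ∀ z, R 0 z ≤ Φ * q z) (ha : β * Φ ≤ a) (haρ : 2 * a ≤ ρ)
    (hR : ∀ x y, q x ≤ ρ → q y ≤ ρ → ∀ z,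
      A (x - y) z - (R x z - R y z) ≤ lam * q (x - y) * q z)
    (hc : β * lam ≤ 1 / 2) :
    ∃ x, q x ≤ 2 * a ∧ R x = 0 ∧ ∀ y, q y ≤ ρ → R y = 0 → y = x := by
  have q_zero : q 0 = 0 := by simpa using q_smul 0 0
  have q_neg : ∀ x, q (-x) = q x := fun x => by simpa using q_smul (-1) x
  have q_nonneg : ∀ x, 0 ≤ q x := fun x => by
    have := q_add x (-x)
    rw [add_neg_cancel, q_zero, q_neg] at this
    linarith
  have hinj : Function.Injective A := by
    rw [injective_iff_map_eq_zero]
    intro v hv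
    refine q_def v ((hA v 0 le_rfl fun w => ?_).trans_eq (mul_zero β))
    -- The stability estimate with Ψ = 0 gives injectivity; equal finite dimensions then give
    -- surjectivity.
    simp [hv]
  have hsurj : Function.Surjective A :=
    (LinearMap.injective_iff_surjective_of_finrank_eq_finrank
      (Subspace.dual_finrank_eq (K := ℝ) (V := X)).symm).mp hinj
  -- D x is the Newton correction A⁻¹R(x) with frozen linearization.
  choose D hD using fun x => hsurj (R x)
  set T : X → X := fun x => x - D x with hT
  have hD0 : q (D 0) ≤ a := (hA _ _ hΦ fun w => by rw [hD]; exact hR0 w).trans ha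
  have hTT : ∀ x y, q x ≤ ρ → q y ≤ ρ → q (T x - T y) ≤ 1 / 2 * q (x - y) := by
    intro x y hx hy
    have h1 : q (T x - T y) ≤ β * (lam * q (x - y)) := by
      refine hA _ _ (mul_nonneg hlam (q_nonneg _)) fun w => ?_
      have : T x - T y = (x - y) - (D x - D y) := by simp only [hT]; abel
      rw [this, map_sub, map_sub A (D x), hD, hD]
      exact hR x y hx hy w
    rw [← mul_assoc] at h1
    exact h1.trans (mul_le_mul_of_nonneg_right hc (q_nonneg _))
  have ha0 : 0 ≤ a := (q_nonneg _).trans hD0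
  -- The first step has length at most a and T contracts by 1/2, so 2a is the sum of the geometric
  -- series. Uniqueness, by contrast, holds in the whole ball of radius ρ.
  have hmaps : ∀ x, q x ≤ 2 * a → q (T x) ≤ 2 * a := by
    intro x hx
    have h1 := hTT x 0 (hx.trans haρ) (by rw [q_zero]; linarith)
    have h2 := q_add (T x - T 0) (T 0)
    have h3 : q (T 0) = q (D 0) := by simp only [hT, zero_sub, q_neg]
    rw [sub_add_cancel] at h2
    rw [sub_zero] at h1
    linarith
  have hfix : ∀ x, T x = x ↔ R x = 0 := by
    intro x
    simp only [hT, sub_eq_self]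
    rw [← hD x]
    exact (map_eq_zero_iff A hinj).symm
  have huniq : ∀ x y, q x ≤ ρ → q y ≤ ρ → R x = 0 → R y = 0 → y = x := by
    intro x y hx hy hx0 hy0
    have h1 := hTT y x hy hx
    rw [(hfix x).mpr hx0, (hfix y).mpr hy0] at h1
    exact sub_eq_zero.mp (q_def _ (by linarith))
  have hex : ∃ x, q x ≤ 2 * a ∧ T x = x := by
    -- Only here does q become the norm of X; completeness follows from finite dimension.
    let _ : NormedAddCommGroup X := AddGroupNorm.toNormedAddCommGroup
      { toFun := q
        map_zero' := q_zero
        add_le' := q_add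
        neg' := q_neg
        eq_zero_of_map_eq_zero' := fun x hx => q_def x hx.le }
    let _ : NormedSpace ℝ X := { norm_smul_le := fun c x => (q_smul c x).le }
    have : CompleteSpace X := FiniteDimensional.complete ℝ X
    have hball : IsComplete (Metric.closedBall (0 : X) (2 * a)) :=
      Metric.isClosed_closedBall.isComplete
    have hm : MapsTo T (Metric.closedBall (0 : X) (2 * a)) (Metric.closedBall (0 : X) (2 * a)) := by
      intro x hx
      rw [mem_closedBall_zero_iff] at hx ⊢
      exact hmaps x hx
    have hK : ContractingWith (1 / 2) (hm.restrict T _ _) := by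
      refine ⟨by norm_num, LipschitzWith.of_dist_le_mul fun x y => ?_⟩
      have hx := mem_closedBall_zero_iff.mp x.2
      have hy := mem_closedBall_zero_iff.mp y.2
      have := hTT x y (LE.le.trans hx haρ) (LE.le.trans hy haρ)
      rw [Subtype.dist_eq, Subtype.dist_eq, dist_eq_norm, dist_eq_norm]
      rw [NNReal.coe_div, NNReal.coe_one, NNReal.coe_ofNat]
      exact this
    obtain ⟨x, hx, hfx, -⟩ := hK.exists_fixedPoint' hball hm
      (Metric.mem_closedBall_self (by linarith)) (edist_ne_top _ _)
    exact ⟨x, mem_closedBall_zero_iff.mp hx, hfx⟩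
  obtain ⟨x, hx, hTx⟩ := hex
  have hRx := (hfix x).mp hTx
  exact ⟨x, hx, hRx, fun y hy hy0 => huniq x y (hx.trans haρ) hy hRx hy0⟩

end Abstract

/-! ### The bilinear forms and the mean value theorem -/

section Forms

variable {n : ℕ} {Ω : Set (E n)} {F : (Fin n → Fin n → ℝ) → E n → ℝ → E n → ℝ}

/-- Representatives of L² classes add only almost everywhere; there are finitely many index pairs,
so one null set serves all entries. -/
lemma hess_add (hΩ : IsOpen Ω) {v v' : L2 Ω} (hv : v ∈ H Ω 2) (hv' : v' ∈ H Ω 2) :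
    ∀ᵐ x ∂((volume : Measure (E n)).restrict Ω),
      hess Ω (v + v') x = hess Ω v x + hess Ω v' x := by
  have : ∀ᵐ x ∂((volume : Measure (E n)).restrict Ω), ∀ i j : Fin n,
      wD Ω ![i, j] (v + v') x = wD Ω ![i, j] v x + wD Ω ![i, j] v' x := by
    refine ae_all_iff.mpr fun i => ae_all_iff.mpr fun j => ?_
    rw [wD_add hΩ le_rfl _ hv hv']
    exact Lp.coeFn_add _ _
  filter_upwards [this] with x hx
  ext i j
  exact hx i j

lemma hess_smul (hΩ : IsOpen Ω) (c : ℝ) {v : L2 Ω} (hv : v ∈ H Ω 2) :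
    ∀ᵐ x ∂((volume : Measure (E n)).restrict Ω), hess Ω (c • v) x = c • hess Ω v x := by
  have : ∀ᵐ x ∂((volume : Measure (E n)).restrict Ω), ∀ i j : Fin n,
      wD Ω ![i, j] (c • v) x = c * wD Ω ![i, j] v x := by
    refine ae_all_iff.mpr fun i => ae_all_iff.mpr fun j => ?_
    rw [wD_smul hΩ le_rfl _ c hv]
    exact Lp.coeFn_smul _ _
  filter_upwards [this] with x hx
  ext i j
  exact hx i j

lemma grad_add (hΩ : IsOpen Ω) {v v' : L2 Ω} (hv : v ∈ H Ω 2) (hv' : v' ∈ H Ω 2) :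
    ∀ᵐ x ∂((volume : Measure (E n)).restrict Ω),
      grad Ω (v + v') x = grad Ω v x + grad Ω v' x := by
  have : ∀ᵐ x ∂((volume : Measure (E n)).restrict Ω), ∀ i : Fin n,
      wD Ω ![i] (v + v') x = wD Ω ![i] v x + wD Ω ![i] v' x := by
    refine ae_all_iff.mpr fun i => ?_
    rw [wD_add hΩ one_le_two _ hv hv']
    exact Lp.coeFn_add _ _
  filter_upwards [this] with x hx
  ext i
  exact hx i

lemma grad_smul (hΩ : IsOpen Ω) (c : ℝ) {v : L2 Ω} (hv : v ∈ H Ω 2) :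
    ∀ᵐ x ∂((volume : Measure (E n)).restrict Ω), grad Ω (c • v) x = c • grad Ω v x := by
  have : ∀ᵐ x ∂((volume : Measure (E n)).restrict Ω), ∀ i : Fin n,
      wD Ω ![i] (c • v) x = c * wD Ω ![i] v x := by
    refine ae_all_iff.mpr fun i => ?_
    rw [wD_smul hΩ one_le_two _ c hv]
    exact Lp.coeFn_smul _ _
  filter_upwards [this] with x hx
  ext i
  exact hx i

lemma opF'_add (hΩ : IsOpen Ω) (w : L2 Ω) {v v' : L2 Ω} (hv : v ∈ H Ω 2) (hv' : v' ∈ H Ω 2) :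
    ∀ᵐ x ∂((volume : Measure (E n)).restrict Ω),
      opF' Ω F w (v + v') x = opF' Ω F w v x + opF' Ω F w v' x := by
  filter_upwards [hess_add hΩ hv hv', grad_add hΩ hv hv', Lp.coeFn_add v v'] with x h2 h1 h0
  simp only [opF', h2, h1, h0, map_add, Pi.add_apply]
  ring

lemma opF'_smul (hΩ : IsOpen Ω) (w : L2 Ω) (c : ℝ) {v : L2 Ω} (hv : v ∈ H Ω 2) :
    ∀ᵐ x ∂((volume : Measure (E n)).restrict Ω),
      opF' Ω F w (c • v) x = c * opF' Ω F w v x := by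
  filter_upwards [hess_smul hΩ c hv, grad_smul hΩ c hv, Lp.coeFn_smul c v] with x h2 h1 h0
  simp only [opF', h2, h1, h0, map_smul, Pi.smul_apply, smul_eq_mul]
  ring

lemma integral_mul_add {f : E n → ℝ} {z z' : L2 Ω}
    (hz : Integrable (fun x => f x * z x) (volume.restrict Ω))
    (hz' : Integrable (fun x => f x * z' x) (volume.restrict Ω)) :
    ∫ x in Ω, f x * (z + z' : L2 Ω) x = (∫ x in Ω, f x * z x) + ∫ x in Ω, f x * z' x := by
  rw [← integral_add hz hz']
  refine integral_congr_ae ?_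
  filter_upwards [Lp.coeFn_add z z'] with x hx
  rw [hx, Pi.add_apply, mul_add]

lemma integral_mul_smul (f : E n → ℝ) (c : ℝ) (z : L2 Ω) :
    ∫ x in Ω, f x * (c • z : L2 Ω) x = c * ∫ x in Ω, f x * z x := by
  rw [← integral_const_mul]
  refine integral_congr_ae ?_
  filter_upwards [Lp.coeFn_smul c z] with x hx
  rw [hx, Pi.smul_apply, smul_eq_mul]
  ring

/-- The form `⟨F'[y](v), z⟩` on `V₀`. -/
noncomputable def derivForm (hΩ : IsOpen Ω) {y : L2 Ω}
    (hy : ∀ v ∈ V0 Ω, ∀ z ∈ V0 Ω,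
      Integrable (fun x => opF' Ω F y v x * z x) (volume.restrict Ω)) :
    V0 Ω →ₗ[ℝ] V0 Ω →ₗ[ℝ] ℝ :=
  LinearMap.mk₂ ℝ (fun v z => pairF' Ω F y v z)
    (fun v v' z => by
      simp only [pairF']
      rw [← integral_add (hy v v.2 z z.2) (hy v' v'.2 z z.2)]
      refine integral_congr_ae ?_
      filter_upwards [opF'_add (F := F) hΩ y v.2.1 v'.2.1] with x hx
      rw [Submodule.coe_add, hx, add_mul])
    (fun c v z => by
      simp only [pairF', smul_eq_mul]
      rw [← integral_const_mul]
      refine integral_congr_ae ?_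
      filter_upwards [opF'_smul (F := F) hΩ y c v.2.1] with x hx
      rw [Submodule.coe_smul, hx, mul_assoc])
    (fun v z z' => integral_mul_add (hy v v.2 z z.2) (hy v v.2 z' z'.2))
    (fun c v z => integral_mul_smul _ c (z : L2 Ω))

/-- The form `(Δv, Δz)` on `V₀`. -/
noncomputable def lapForm (hΩ : IsOpen Ω) : V0 Ω →ₗ[ℝ] V0 Ω →ₗ[ℝ] ℝ :=
  LinearMap.mk₂ ℝ (fun v z => inner ℝ (lap Ω (v : L2 Ω)) (lap Ω (z : L2 Ω)))
    (fun v v' z => by rw [Submodule.coe_add, lap_add hΩ v.2.1 v'.2.1, inner_add_left])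
    (fun c v z => by
      rw [Submodule.coe_smul, lap_smul hΩ c v.2.1, real_inner_smul_left, smul_eq_mul])
    (fun v z z' => by rw [Submodule.coe_add, lap_add hΩ z.2.1 z'.2.1, inner_add_right])
    (fun c v z => by
      rw [Submodule.coe_smul, lap_smul hΩ c z.2.1, real_inner_smul_right, smul_eq_mul])

lemma abs_inner_lap_le (v z : L2 Ω) :
    |inner ℝ (lap Ω v) (lap Ω z)| ≤ (n : ℝ) ^ 2 * hNorm Ω 2 v * hNorm Ω 2 z := by
  refine (abs_real_inner_le_norm _ _).trans ?_
  refine (mul_le_mul (norm_lap_le v) (norm_lap_le z) (norm_nonneg _) ?_).trans_eq (by ring)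
  exact mul_nonneg (Nat.cast_nonneg n) (hNorm_nonneg 2 v)

/-- A bound for `‖B‖_{VV*}` bounds the values of the bilinear form `B`. -/
lemma abs_le_of_vvNorm_le (hΩ : IsOpen Ω) {B : L2 Ω → L2 Ω → ℝ} (B' : V0 Ω →ₗ[ℝ] V0 Ω →ₗ[ℝ] ℝ)
    (hB : ∀ v z : V0 Ω, B v z = B' v z) {b : ℝ} (hb : 0 ≤ b)
    (h : vvNorm Ω B ≤ ENNReal.ofReal b) {v z : L2 Ω} (hv : v ∈ V0 Ω) (hz : z ∈ V0 Ω) :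
    |B v z| ≤ b * hNorm Ω 2 v * hNorm Ω 2 z := by
  -- Where a norm vanishes the quotient carries no information, but there the function itself is
  -- zero.
  have key : ∀ v z : V0 Ω, B' v z ≤ b * hNorm Ω 2 (v : L2 Ω) * hNorm Ω 2 (z : L2 Ω) := by
    intro v z
    rcases (hNorm_nonneg 2 (v : L2 Ω)).eq_or_lt with hv0 | hv0
    · have : v = 0 := Subtype.ext (eq_zero_of_hNorm_le_zero hΩ hv0.ge)
      subst this
      simp [hNorm_zero hΩ]
    rcases (hNorm_nonneg 2 (z : L2 Ω)).eq_or_lt with hz0 | hz0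
    · have : z = 0 := Subtype.ext (eq_zero_of_hNorm_le_zero hΩ hz0.ge)
      subst this
      simp [hNorm_zero hΩ]
    have h1 : ENNReal.ofReal (B v z / (hNorm Ω 2 (v : L2 Ω) * hNorm Ω 2 (z : L2 Ω))) ≤
        vvNorm Ω B :=
      le_iSup₂_of_le (v : L2 Ω) v.2 (le_iSup₂_of_le (z : L2 Ω) z.2 le_rfl)
    have h2 := (ENNReal.ofReal_le_ofReal_iff hb).mp (h1.trans h)
    rw [div_le_iff₀ (mul_pos hv0 hz0), hB] at h2
    linarith
  have h1 := key ⟨v, hv⟩ ⟨z, hz⟩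
  -- `ENNReal.ofReal` discards negative values, so the lower bound has to come from -z.
  have h2 := key ⟨v, hv⟩ (-⟨z, hz⟩)
  rw [map_neg, Submodule.coe_neg, hNorm_neg hΩ hz.1] at h2
  have h3 := hB ⟨v, hv⟩ ⟨z, hz⟩
  simp only at h1 h2 h3
  rw [h3]
  exact abs_le.mpr ⟨by linarith, h1⟩

/-- The linearization `G_ε'[y]` on `V₀`. -/
noncomputable def linForm (hΩ : IsOpen Ω) (ε : ℝ) {y : L2 Ω}
    (hy : ∀ v ∈ V0 Ω, ∀ z ∈ V0 Ω,
      Integrable (fun x => opF' Ω F y v x * z x) (volume.restrict Ω)) :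
    V0 Ω →ₗ[ℝ] V0 Ω →ₗ[ℝ] ℝ :=
  ε • lapForm hΩ + derivForm hΩ hy

lemma linForm_apply (hΩ : IsOpen Ω) (ε : ℝ) {y : L2 Ω}
    (hy : ∀ v ∈ V0 Ω, ∀ z ∈ V0 Ω,
      Integrable (fun x => opF' Ω F y v x * z x) (volume.restrict Ω)) (v z : V0 Ω) :
    linForm hΩ ε hy v z = pairG' Ω F ε y v z := rfl

variable {g : E n → ℝ} {Y : Submodule ℝ (L2 Ω)}

/-- The mean value theorem for `w ↦ (F(w), z)` on `Y ∩ V_g`. -/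
lemma IsDerivativeOn.exists_mean_value (hF' : IsDerivativeOn (Ω := Ω) F g Y) {w w' z : L2 Ω}
    (hwY : w ∈ Y) (hw : w ∈ Vg Ω g) (hwY' : w' ∈ Y) (hw' : w' ∈ Vg Ω g) (hz : z ∈ V0 Ω) :
    ∃ t ∈ Ioo (0 : ℝ) 1,
      pairF Ω F w' z - pairF Ω F w z = pairF' Ω F (w + t • (w' - w)) (w' - w) z := by
  have hd : w' - w ∈ V0 Ω := Vg_sub hw' hw
  have hdY : w' - w ∈ Y := sub_mem hwY' hwY
  -- Differentiability is assumed at parameter 0 only. The whole line stays in Y ∩ V_g, so it is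
  -- applied at the point with parameter t and shifted.
  have hder : ∀ t : ℝ, HasDerivAt (fun t : ℝ => pairF Ω F (w + t • (w' - w)) z)
      (pairF' Ω F (w + t • (w' - w)) (w' - w) z) t := by
    intro t
    have h := hF'.2.2 (w + t • (w' - w)) (add_mem hwY (Submodule.smul_mem _ t hdY))
      (Vg_add hw (Submodule.smul_mem _ t hd)) (w' - w) hdY hd z hz
    have h' := HasDerivAt.comp_sub_const t t (by rwa [sub_self])
    refine h'.congr_of_eventuallyEq (Eventually.of_forall fun τ => ?_)
    simp only
    rw [add_assoc, ← add_smul, add_sub_cancel]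
  obtain ⟨t, ht, h⟩ := exists_hasDerivAt_eq_slope _ _ (zero_lt_one' ℝ)
    (fun t _ => (hder t).continuousAt.continuousWithinAt) (fun t _ => hder t)
  refine ⟨t, ht, ?_⟩
  rw [h]
  simp

end Forms

/-! ### Schatz' argument at the level of constants -/

section Constants

lemma cM_pos {C₀ C₁ CR : ℝ} (h : 0 < C₁) : 0 < cM C₀ C₁ CR :=
  lt_max_of_lt_left (Real.rpow_pos_of_pos h _)

lemma rpow_neg_half_sq {C₁ : ℝ} (h : 0 < C₁) : (C₁ ^ (-(1 / 2) : ℝ)) ^ 2 = C₁⁻¹ := by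
  rw [← Real.rpow_natCast, ← Real.rpow_mul h.le]
  norm_num
  exact Real.rpow_neg_one C₁

/-- The two entries of the maximum M are the two scales in Schatz' argument: C₁⁻¹ comes from Young's
inequality, C₀ C_R² from the dual bound. -/
lemma inv_le_cM_sq {C₀ C₁ CR : ℝ} (h : 0 < C₁) : C₁⁻¹ ≤ cM C₀ C₁ CR ^ 2 := by
  rw [← rpow_neg_half_sq h]
  exact pow_le_pow_left₀ (Real.rpow_pos_of_pos h _).le (le_max_left _ _) 2

lemma mul_sq_le_cM_sq {C₀ C₁ CR : ℝ} (h0 : 0 ≤ C₀) (hR : 0 ≤ CR) :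
    C₀ * CR ^ 2 ≤ cM C₀ C₁ CR ^ 2 := by
  have : C₀ * CR ^ 2 = (C₀ ^ (1 / 2 : ℝ) * CR) ^ 2 := by
    rw [mul_pow, ← Real.rpow_natCast (C₀ ^ (1 / 2 : ℝ)), ← Real.rpow_mul h0]
    norm_num
  rw [this]
  exact pow_le_pow_left₀ (by positivity) (le_max_right _ _) 2

/-- Schatz' argument: a Gårding inequality together with a weak bound for the lower order norm
gives coercivity. -/
lemma garding_absorption {C₀ C₁ C₂ CR G η x y Ψ : ℝ} (h0 : 0 ≤ C₀) (h1 : 0 < C₁)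
    (hR : 0 < CR) (hG : 0 < G) (hy : 0 ≤ y) (hΨ : 0 ≤ Ψ)
    (hgarding : C₁ * x ^ 2 - C₀ * y ^ 2 ≤ Ψ * x) (hdual : y ≤ G * CR * (C₂ * η * x + Ψ))
    (hη : 8 * G ^ 2 * (C₀ * C₂ ^ 2 * CR ^ 2 * η ^ 2) ≤ C₁) :
    x ≤ (2 + 4 * G ^ 2) * (C₁ ^ (-(1 / 2) : ℝ) * cM C₀ C₁ CR) * Ψ := by
  have hM := cM_pos (C₀ := C₀) (CR := CR) h1
  set a := C₁ ^ (-(1 / 2) : ℝ) with ha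
  have ha0 : 0 < a := Real.rpow_pos_of_pos h1 _
  have ha2 : a ^ 2 = C₁⁻¹ := rpow_neg_half_sq h1
  set M := cM C₀ C₁ CR with hMdef
  have e1 : C₁⁻¹ ≤ M ^ 2 := inv_le_cM_sq h1
  have e2 : C₀ * CR ^ 2 ≤ M ^ 2 := mul_sq_le_cM_sq h0 hR.le
  have s1 : y ^ 2 ≤ G ^ 2 * CR ^ 2 * (2 * (C₂ * η * x) ^ 2 + 2 * Ψ ^ 2) := by
    calc y ^ 2 ≤ (G * CR * (C₂ * η * x + Ψ)) ^ 2 := pow_le_pow_left₀ hy hdual 2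
      _ = G ^ 2 * CR ^ 2 * (C₂ * η * x + Ψ) ^ 2 := by ring
      _ ≤ _ := by
        gcongr
        nlinarith [sq_nonneg (C₂ * η * x - Ψ)]
  -- The factor 8G² in `hη` is chosen to leave exactly C₁/4 here; Young's inequality below costs
  -- another C₁/4, so half of the coercive term survives.
  have s2 : C₀ * y ^ 2 ≤ C₁ / 4 * x ^ 2 + 2 * G ^ 2 * M ^ 2 * Ψ ^ 2 := by
    calc C₀ * y ^ 2 ≤ C₀ * (G ^ 2 * CR ^ 2 * (2 * (C₂ * η * x) ^ 2 + 2 * Ψ ^ 2)) := by gcongr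
      _ = (8 * G ^ 2 * (C₀ * C₂ ^ 2 * CR ^ 2 * η ^ 2)) / 4 * x ^ 2 +
          2 * G ^ 2 * (C₀ * CR ^ 2) * Ψ ^ 2 := by ring
      _ ≤ _ := by gcongr
  have s3 : Ψ * x ≤ C₁ / 4 * x ^ 2 + M ^ 2 * Ψ ^ 2 := by
    have : Ψ * x ≤ C₁ / 4 * x ^ 2 + C₁⁻¹ * Ψ ^ 2 := by
      have hsq : 0 ≤ C₁ * (x / 2 - C₁⁻¹ * Ψ) ^ 2 := by positivity
      have hCC : C₁ * C₁⁻¹ = 1 := mul_inv_cancel₀ h1.ne'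
      have : C₁ * (x / 2 - C₁⁻¹ * Ψ) ^ 2 =
          C₁ / 4 * x ^ 2 - (C₁ * C₁⁻¹) * (Ψ * x) + (C₁ * C₁⁻¹) * C₁⁻¹ * Ψ ^ 2 := by ring
      rw [this, hCC] at hsq
      linarith
    refine this.trans ?_
    gcongr
  have s4 : C₁ * x ^ 2 ≤ (2 + 4 * G ^ 2) * M ^ 2 * Ψ ^ 2 := by linarith
  have s5 : x ^ 2 ≤ (2 + 4 * G ^ 2) * (a * M * Ψ) ^ 2 := by
    have : x ^ 2 = a ^ 2 * (C₁ * x ^ 2) := by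
      rw [ha2, ← mul_assoc, inv_mul_cancel₀ h1.ne', one_mul]
    rw [this]
    calc a ^ 2 * (C₁ * x ^ 2) ≤ a ^ 2 * ((2 + 4 * G ^ 2) * M ^ 2 * Ψ ^ 2) := by gcongr
      _ = _ := by ring
  refine le_of_sq_le_sq ?_ (by positivity)
  calc x ^ 2 ≤ (2 + 4 * G ^ 2) * (a * M * Ψ) ^ 2 := s5
    _ ≤ (2 + 4 * G ^ 2) ^ 2 * (a * M * Ψ) ^ 2 := by
      gcongr
      nlinarith [sq_nonneg G]
    _ = _ := by ring

/-- The mesh condition `h ≤ h₀` in the form in which it enters Schatz' argument. -/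
lemma mul_rpow_sq_le_of_le_h0 {C₀ C₁ C₂ CR c h r γ : ℝ} (hC0 : 0 ≤ C₀) (h1 : 0 < C₁)
    (h2 : 0 < C₂) (hR : 0 < CR) (hr : 2 < r) (hh : 0 < h) (hγ : 0 < γ)
    (hcγ : c ≤ γ ^ (1 / (2 * r - 4))) (hh0 : h ≤ h0 c C₀ C₁ C₂ CR r) :
    C₀ * C₂ ^ 2 * CR ^ 2 * (h ^ (r - 2)) ^ 2 ≤ γ * C₁ := by
  rcases hC0.eq_or_lt with rfl | hpos
  · simp only [zero_mul]
    positivity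
  rw [h0, if_neg hpos.ne'] at hh0
  set Q := C₀ * C₁⁻¹ * C₂ ^ 2 * CR ^ 2 with hQ
  have hQ0 : 0 < Q := by positivity
  have hr' : (0 : ℝ) < 2 * r - 4 := by linarith
  have e1 : (h ^ (r - 2)) ^ 2 = h ^ (2 * r - 4) := by
    rw [← Real.rpow_natCast, ← Real.rpow_mul hh.le]
    congr 1
    push_cast
    ring
  -- The exponent 1/(4 - 2r) in h₀ is the one that turns Q into Q⁻¹ under the power 2r - 4.
  have e2 : h ^ (2 * r - 4) ≤ γ * Q⁻¹ := by
    calc h ^ (2 * r - 4) ≤ (γ ^ (1 / (2 * r - 4)) * Q ^ (1 / (4 - 2 * r))) ^ (2 * r - 4) := by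
          refine Real.rpow_le_rpow hh.le (hh0.trans ?_) hr'.le
          gcongr
      _ = γ * Q⁻¹ := by
          rw [Real.mul_rpow (by positivity) (by positivity), ← Real.rpow_mul hγ.le,
            ← Real.rpow_mul hQ0.le, one_div_mul_cancel hr'.ne', Real.rpow_one]
          have : 1 / (4 - 2 * r) * (2 * r - 4) = -1 := by
            have : (4 - 2 * r) ≠ 0 := by linarith
            field_simp
            ring
          rw [this, Real.rpow_neg_one]
  rw [e1]
  calc C₀ * C₂ ^ 2 * CR ^ 2 * h ^ (2 * r - 4) ≤ C₀ * C₂ ^ 2 * CR ^ 2 * (γ * Q⁻¹) := by gcongr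
    _ = γ * C₁ := by
      rw [hQ]
      field_simp

end Constants

/-! ### The adjoint problem and discrete stability -/

section Stability

variable {n : ℕ} {Ω : Set (E n)} {F : (Fin n → Fin n → ℝ) → E n → ℝ → E n → ℝ} {g : E n → ℝ}
  {k : ℕ} {S : ConformingFE Ω k} {ε₀ p κ : ℝ} {u : ℝ → L2 Ω} {C₀ C₁ C₂ CR : ℝ → ℝ}
  {Y : Submodule ℝ (L2 Ω)}

/-- Solutions of the adjoint problem and their interpolants. -/
lemma exists_dual_solution (hΩ : IsOpen Ω) (hn : 1 ≤ n) (hb : Bornology.IsBounded Ω)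
    (hne : Ω.Nonempty) (hk : 4 < k) (hSp : S.Approximates p) (h2 : A2 F ε₀ p u C₀ C₁ C₂ CR) :
    ∃ Γ > 0, ∀ ε ∈ Ioc 0 ε₀, ∀ h ∈ S.sizes, ∀ φ : L2 Ω, ∃ z ∈ V0 Ω,
      (∀ w ∈ V0 Ω, pairG' Ω F ε (u ε) w z = inner ℝ φ w) ∧
      hNorm Ω 2 (z - S.interp h z) ≤ Γ * h ^ (min p ((k : ℝ) + 1) - 2) * CR ε * ‖φ‖ ∧
      hNorm Ω 2 (S.interp h z) ≤ Γ * CR ε * ‖φ‖ := by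
  obtain ⟨B, hB, hBh⟩ := S.exists_size_bound hn hb hne
  obtain ⟨Cp, hCp, happ⟩ := hSp
  set r := min p ((k : ℝ) + 1) with hr
  have hk' : (4 : ℝ) < k := by exact_mod_cast hk
  have hr2 : 2 < r := lt_min h2.1 (by linarith)
  -- Cp serves the interpolation error, and 1 + Cp B^(r-2) the interpolant itself, where B bounds
  -- all mesh sizes.
  refine ⟨1 + Cp + Cp * B ^ (r - 2), by positivity, fun ε hε h hh φ => ?_⟩
  obtain ⟨-, -, -, hCR, hiso, -, -, hreg⟩ := h2.2 ε hε
  obtain ⟨z, hz, -⟩ := hiso ((innerₛₗ ℝ φ).comp (V0 Ω).subtype)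
    ⟨‖φ‖, fun w => (abs_real_inner_le_norm φ (w : L2 Ω)).trans
      (mul_le_mul_of_nonneg_left (norm_le_hNorm hΩ 2 _) (norm_nonneg _))⟩
  have hz' : ∀ w ∈ V0 Ω, pairG' Ω F ε (u ε) w z = inner ℝ φ w := fun w hw => hz ⟨w, hw⟩
  obtain ⟨hzp, hzn⟩ := hreg φ z z.2 hz'
  have hhpos := S.sizes_pos h hh
  have hzr : hsNorm Ω r (z : L2 Ω) ≤ CR ε * ‖φ‖ := by
    refine le_trans ?_ hzn
    have := hsNorm_min_natCast_le p (k + 1) (z : L2 Ω)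
    push_cast at this
    exact this
  have hz2 : hNorm Ω 2 (z : L2 Ω) ≤ CR ε * ‖φ‖ :=
    (hNorm_le_hsNorm (by exact_mod_cast hr2.le) _).trans hzr
  have hη : 0 < h ^ (r - 2) := Real.rpow_pos_of_pos hhpos _
  have hηB : h ^ (r - 2) ≤ B ^ (r - 2) :=
    Real.rpow_le_rpow hhpos.le (hBh h hh) (by linarith)
  have hB0 : 0 < B ^ (r - 2) := Real.rpow_pos_of_pos hB _
  have hCφ : 0 ≤ CR ε * ‖φ‖ := mul_nonneg hCR.le (norm_nonneg _)
  have hint : hNorm Ω 2 (z - S.interp h z) ≤ Cp * h ^ (r - 2) * (CR ε * ‖φ‖) := by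
    refine (happ h hh z z.2.1 hzp 2 le_rfl).trans ?_
    rw [Nat.cast_ofNat]
    gcongr
  refine ⟨z, z.2, hz', hint.trans ?_, ?_⟩
  · rw [← mul_assoc]
    have : 0 ≤ Cp * B ^ (r - 2) := by positivity
    gcongr
    linarith
  · have hI : S.interp h z ∈ H Ω 2 := S.conforming h hh (S.interp_mem h hh z z.2.1)
    have h3 := hNorm_sub_le hΩ z.2.1 (sub_mem z.2.1 hI)
    rw [sub_sub_cancel] at h3
    calc hNorm Ω 2 (S.interp h z) ≤ CR ε * ‖φ‖ + Cp * B ^ (r - 2) * (CR ε * ‖φ‖) := by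
          refine h3.trans (add_le_add hz2 (hint.trans ?_))
          gcongr
      _ ≤ _ := by nlinarith [mul_nonneg hCp.le hCφ]

/-- Continuity of `G_ε'[u^ε]`. -/
lemma abs_pairG'_le (hΩ : IsOpen Ω) (hF' : IsDerivativeOn (Ω := Ω) F g Y)
    (h2 : A2 F ε₀ p u C₀ C₁ C₂ CR) (hκ₂ : ∀ ε ∈ Ioc 0 ε₀, ε ≤ κ * C₂ ε) {ε : ℝ}
    (hε : ε ∈ Ioc 0 ε₀) (huY : u ε ∈ Y) {v z : L2 Ω} (hv : v ∈ V0 Ω) (hz : z ∈ V0 Ω) :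
    |pairG' Ω F ε (u ε) v z| ≤ (κ * n ^ 2 + 1) * C₂ ε * hNorm Ω 2 v * hNorm Ω 2 z := by
  obtain ⟨-, -, hC2, -, -, -, hvv, -⟩ := h2.2 ε hε
  have e1 := abs_le_of_vvNorm_le hΩ (derivForm hΩ (hF'.1 (u ε) huY)) (fun _ _ => rfl) hC2.le hvv
    hv hz
  have e2 := abs_inner_lap_le v z
  have hvz : 0 ≤ hNorm Ω 2 v * hNorm Ω 2 z := mul_nonneg (hNorm_nonneg _ _) (hNorm_nonneg _ _)
  calc |pairG' Ω F ε (u ε) v z|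
      ≤ |ε * inner ℝ (lap Ω v) (lap Ω z)| + |pairF' Ω F (u ε) v z| := abs_add_le _ _
    _ ≤ (κ * C₂ ε) * (n ^ 2 * hNorm Ω 2 v * hNorm Ω 2 z) +
        C₂ ε * hNorm Ω 2 v * hNorm Ω 2 z := by
      refine add_le_add ?_ e1
      rw [abs_mul, abs_of_pos hε.1]
      exact mul_le_mul (hκ₂ ε hε) e2 (abs_nonneg _) (hε.1.le.trans (hκ₂ ε hε))
    _ = _ := by ring

lemma pairG'_add_right (hΩ : IsOpen Ω) (hF' : IsDerivativeOn (Ω := Ω) F g Y) (ε : ℝ) {y : L2 Ω}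
    (hy : y ∈ Y) {v z z' : L2 Ω} (hv : v ∈ V0 Ω) (hz : z ∈ V0 Ω) (hz' : z' ∈ V0 Ω) :
    pairG' Ω F ε y v (z + z') = pairG' Ω F ε y v z + pairG' Ω F ε y v z' := by
  have h := map_add (linForm hΩ ε (hF'.1 y hy) ⟨v, hv⟩) ⟨z, hz⟩ ⟨z', hz'⟩
  rw [linForm_apply, linForm_apply, linForm_apply] at h
  exact h

/-- Stability of the linearized method. -/
lemma exists_discrete_stability (hΩ : IsOpen Ω) (hn : 1 ≤ n) (hb : Bornology.IsBounded Ω)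
    (hne : Ω.Nonempty) (hk : 4 < k) (hSp : S.Approximates p) (h2 : A2 F ε₀ p u C₀ C₁ C₂ CR)
    (hF' : IsDerivativeOn (Ω := Ω) F g Y) (huY : ∀ ε ∈ Ioc 0 ε₀, u ε ∈ Y) (hκ : 0 < κ)
    (hκ₂ : ∀ ε ∈ Ioc 0 ε₀, ε ≤ κ * C₂ ε) :
    ∃ c₀ > 0, ∃ Cs > 0, ∀ c, c ≤ c₀ → ∀ ε ∈ Ioc 0 ε₀, ∀ h ∈ S.sizes,
      h ≤ h0 c (C₀ ε) (C₁ ε) (C₂ ε) (CR ε) (min p ((k : ℝ) + 1)) →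
      ∀ v ∈ S.V0h h, ∀ Ψ, 0 ≤ Ψ →
        (∀ w ∈ S.V0h h, pairG' Ω F ε (u ε) v w ≤ Ψ * hNorm Ω 2 w) →
        hNorm Ω 2 v ≤ Cs * (C₁ ε ^ (-(1 / 2) : ℝ) * cM (C₀ ε) (C₁ ε) (CR ε)) * Ψ := by
  obtain ⟨Γ, hΓ, hdual⟩ := exists_dual_solution hΩ hn hb hne hk hSp h2
  set r := min p ((k : ℝ) + 1) with hr
  have hk' : (4 : ℝ) < k := by exact_mod_cast hk
  have hr2 : 2 < r := lt_min h2.1 (by linarith)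
  set G := Γ * (κ * n ^ 2 + 1) with hG
  have hG0 : 0 < G := by positivity
  -- The first witness is the threshold of `mul_rpow_sq_le_of_le_h0` for γ = 1/(8G²), as
  -- `garding_absorption` requires; the second is the constant of that lemma.
  refine ⟨(1 / (8 * G ^ 2)) ^ (1 / (2 * r - 4)), by positivity, 2 + 4 * G ^ 2, by positivity,
    fun c hcc ε hε h hh hh0 v hv Ψ hΨ hvΨ => ?_⟩
  obtain ⟨hC0, hC1, hC2, hCR, -, hgard, -, -⟩ := h2.2 ε hε
  have hv0 : v ∈ V0 Ω := ConformingFE.V0h_le hh hv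
  have hhpos := S.sizes_pos h hh
  have hη := mul_rpow_sq_le_of_le_h0 hC0 hC1 hC2 hCR hr2 hhpos (by positivity) hcc hh0
  refine garding_absorption (y := ‖v‖) (η := h ^ (r - 2)) (C₂ := C₂ ε) hC0 hC1 hCR hG0
    (norm_nonneg v) hΨ ((hgard v hv0).trans (hvΨ v hv)) ?_ ?_
  · obtain ⟨z, hz, hzw, hz1, hz2⟩ := hdual ε hε h hh v
    have hI : S.interp h z ∈ S.V0h h := ConformingFE.interp_mem_V0h hh hz
    have hI0 : S.interp h z ∈ V0 Ω := ConformingFE.V0h_le hh hI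
    -- The bound by Ψ applies only to discrete test functions, hence the splitting of z; the
    -- remainder is small by interpolation.
    have e1 : ‖v‖ ^ 2 = pairG' Ω F ε (u ε) v (z - S.interp h z) +
        pairG' Ω F ε (u ε) v (S.interp h z) := by
      rw [← pairG'_add_right hΩ hF' ε (huY ε hε) hv0 (sub_mem hz hI0) hI0, sub_add_cancel,
        hzw v hv0, real_inner_self_eq_norm_sq]
    have e2 : pairG' Ω F ε (u ε) v (z - S.interp h z) ≤ (κ * n ^ 2 + 1) * C₂ ε * hNorm Ω 2 v *
        (Γ * h ^ (r - 2) * CR ε * ‖v‖) := by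
      refine ((le_abs_self _).trans (abs_pairG'_le hΩ hF' h2 hκ₂ hε (huY ε hε) hv0
        (sub_mem hz hI0))).trans ?_
      have := hNorm_nonneg 2 v
      gcongr
    have e3 : pairG' Ω F ε (u ε) v (S.interp h z) ≤ Ψ * (Γ * CR ε * ‖v‖) :=
      (hvΨ _ hI).trans (mul_le_mul_of_nonneg_left hz2 hΨ)
    have e4 : Γ * CR ε * Ψ ≤ G * CR ε * Ψ := by
      have : Γ ≤ G := by
        rw [hG]
        exact le_mul_of_one_le_right hΓ.le (by linarith [show 0 ≤ κ * (n : ℝ) ^ 2 by positivity])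
      gcongr
    have e5 : ‖v‖ * ‖v‖ ≤ (G * CR ε * (C₂ ε * h ^ (r - 2) * hNorm Ω 2 v + Ψ)) * ‖v‖ := by
      have := mul_le_mul_of_nonneg_right e4 (norm_nonneg v)
      rw [hG] at this ⊢
      linarith
    rcases (norm_nonneg v).eq_or_lt with h0 | h0
    · rw [← h0]
      have := hNorm_nonneg 2 v
      have : 0 < h ^ (r - 2) := Real.rpow_pos_of_pos hhpos _
      positivity
    · exact le_of_mul_le_mul_right e5 h0
  · calc 8 * G ^ 2 * (C₀ ε * C₂ ε ^ 2 * CR ε ^ 2 * (h ^ (r - 2)) ^ 2)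
        ≤ 8 * G ^ 2 * (1 / (8 * G ^ 2) * C₁ ε) := by gcongr
      _ = C₁ ε := by field_simp

end Stability

/-! ### Residual, consistency and linearization error -/

section Residual

variable {n : ℕ} {Ω : Set (E n)} {F : (Fin n → Fin n → ℝ) → E n → ℝ → E n → ℝ} {g : E n → ℝ}
  {κ : ℝ} {Y : Submodule ℝ (L2 Ω)} {N : L2 Ω → ℝ}

/-- The functional `z ↦ (F(w), z)` on `V₀`. -/
noncomputable def pairFForm {w : L2 Ω}
    (hw : ∀ z ∈ V0 Ω, Integrable (fun x => opF Ω F w x * z x) (volume.restrict Ω)) :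
    V0 Ω →ₗ[ℝ] ℝ where
  toFun z := pairF Ω F w z
  map_add' z z' := integral_mul_add (hw z z.2) (hw z' z'.2)
  map_smul' c z := integral_mul_smul _ c (z : L2 Ω)

/-- The residual of `w ∈ V_g`, relative to the exact solution `u`. -/
noncomputable def residual (hΩ : IsOpen Ω) (ε : ℝ) {u w : L2 Ω} (huw : w - u ∈ V0 Ω)
    (hu : ∀ z ∈ V0 Ω, Integrable (fun x => opF Ω F u x * z x) (volume.restrict Ω))
    (hw : ∀ z ∈ V0 Ω, Integrable (fun x => opF Ω F w x * z x) (volume.restrict Ω)) :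
    V0 Ω →ₗ[ℝ] ℝ :=
  ε • lapForm hΩ ⟨w - u, huw⟩ + (pairFForm hw - pairFForm hu)

lemma residual_apply (hΩ : IsOpen Ω) (ε : ℝ) {u w : L2 Ω} (huw : w - u ∈ V0 Ω)
    (hu : ∀ z ∈ V0 Ω, Integrable (fun x => opF Ω F u x * z x) (volume.restrict Ω))
    (hw : ∀ z ∈ V0 Ω, Integrable (fun x => opF Ω F w x * z x) (volume.restrict Ω)) (z : V0 Ω) :
    residual hΩ ε huw hu hw z = ε * inner ℝ (lap Ω (w - u)) (lap Ω (z : L2 Ω)) +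
      (pairF Ω F w z - pairF Ω F u z) := rfl

/-- A function in `V_g ∩ Y` satisfies the variational equation iff its residual vanishes. -/
lemma momentEq_iff (hΩ : IsOpen Ω) {ε : ℝ} {u w z : L2 Ω} (hu : u ∈ H Ω 2) (hw : w ∈ H Ω 2)
    (hwz : Integrable (fun x => opF Ω F w x * z x) (volume.restrict Ω))
    (huz : MomentEq Ω F ε u z) :
    MomentEq Ω F ε w z ↔ ε * inner ℝ (lap Ω (w - u)) (lap Ω z) +
      (pairF Ω F w z - pairF Ω F u z) = 0 := by
  rw [MomentEq, ← huz.2, lap_sub hΩ hw hu, inner_sub_left]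
  constructor
  · rintro ⟨-, h⟩
    linarith
  · intro h
    exact ⟨hwz, by linarith⟩

/-- Consistency error of an approximation `w` of `u^ε` that is bounded in `Y`. -/
lemma abs_residual_le (hΩ : IsOpen Ω) (hF' : IsDerivativeOn (Ω := Ω) F g Y)
    (hN : IsNormOn Y N) {ε C₃ C₄ : ℝ} (hε : 0 ≤ ε) (hC₃ : 0 ≤ C₃) (hC₄ : 0 ≤ C₄)
    (hvv : ∀ y ∈ Y, vvNorm Ω (pairF' Ω F y) ≤ ENNReal.ofReal (C₃ * N y)) {u w z : L2 Ω}
    (huY : u ∈ Y) (hu : u ∈ Vg Ω g) (hwY : w ∈ Y) (hw : w ∈ Vg Ω g) (hz : z ∈ V0 Ω)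
    (hNu : 0 ≤ N u) (hNw : N w ≤ C₄ * N u) (hκY : ε ≤ κ * N u) :
    |ε * inner ℝ (lap Ω (w - u)) (lap Ω z) + (pairF Ω F w z - pairF Ω F u z)| ≤
      (κ * n ^ 2 + C₃ * (1 + C₄)) * N u * hNorm Ω 2 (w - u) * hNorm Ω 2 z := by
  obtain ⟨t, ht, hmv⟩ := hF'.exists_mean_value huY hu hwY hw hz
  have hd := Vg_sub hw hu
  have hyY : u + t • (w - u) ∈ Y := add_mem huY (Submodule.smul_mem _ t (sub_mem hwY huY))
  have hNy : N (u + t • (w - u)) ≤ (1 + C₄) * N u := by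
    -- As a convex combination, the mean value point inherits the bound in Y from the end points.
    have e : u + t • (w - u) = (1 - t) • u + t • w := by module
    rw [e]
    refine (hN.1 _ (Submodule.smul_mem _ _ huY) _ (Submodule.smul_mem _ _ hwY)).trans ?_
    rw [hN.2 _ _ huY, hN.2 _ _ hwY, abs_of_pos (sub_pos.mpr ht.2), abs_of_pos ht.1]
    have h1 : (1 - t) * N u ≤ 1 * N u := mul_le_mul_of_nonneg_right (by linarith [ht.1]) hNu
    have h2 : t * N w ≤ t * (C₄ * N u) := mul_le_mul_of_nonneg_left hNw ht.1.le
    have h3 : t * (C₄ * N u) ≤ 1 * (C₄ * N u) :=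
      mul_le_mul_of_nonneg_right ht.2.le (mul_nonneg hC₄ hNu)
    linarith
  have hb : 0 ≤ C₃ * ((1 + C₄) * N u) := by positivity
  have e1 := abs_le_of_vvNorm_le hΩ (derivForm hΩ (hF'.1 _ hyY)) (fun _ _ => rfl) hb
    ((hvv _ hyY).trans (ENNReal.ofReal_le_ofReal (mul_le_mul_of_nonneg_left hNy hC₃))) hd hz
  rw [hmv]
  calc _ ≤ |ε * inner ℝ (lap Ω (w - u)) (lap Ω z)| +
        |pairF' Ω F (u + t • (w - u)) (w - u) z| := abs_add_le _ _
    _ ≤ (κ * N u) * (n ^ 2 * hNorm Ω 2 (w - u) * hNorm Ω 2 z) +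
        C₃ * ((1 + C₄) * N u) * hNorm Ω 2 (w - u) * hNorm Ω 2 z := by
      refine add_le_add ?_ e1
      rw [abs_mul, abs_of_nonneg hε]
      exact mul_le_mul hκY (abs_inner_lap_le _ _) (abs_nonneg _) (hε.trans hκY)
    _ = _ := by ring

/-- The linearization error of the residual, under a Lipschitz bound for `F'` on the segment
that joins `w` to `w'`. -/
lemma abs_linearization_error_le (hΩ : IsOpen Ω) (hF' : IsDerivativeOn (Ω := Ω) F g Y)
    {ε b : ℝ} (hb : 0 ≤ b) {u w w' z : L2 Ω} (huY : u ∈ Y) (hwY : w ∈ Y) (hw : w ∈ Vg Ω g)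
    (hwY' : w' ∈ Y) (hw' : w' ∈ Vg Ω g) (hz : z ∈ V0 Ω)
    (hvv : ∀ t ∈ Ioo (0 : ℝ) 1, vvNorm Ω (fun v z => pairF' Ω F u v z -
      pairF' Ω F (w + t • (w' - w)) v z) ≤ ENNReal.ofReal b) :
    |pairG' Ω F ε u (w' - w) z - (ε * inner ℝ (lap Ω (w' - w)) (lap Ω z) +
      (pairF Ω F w' z - pairF Ω F w z))| ≤ b * hNorm Ω 2 (w' - w) * hNorm Ω 2 z := by
  obtain ⟨t, ht, hmv⟩ := hF'.exists_mean_value hwY hw hwY' hw' hz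
  have hyY : w + t • (w' - w) ∈ Y := add_mem hwY (Submodule.smul_mem _ t (sub_mem hwY' hwY))
  have e1 := abs_le_of_vvNorm_le hΩ (derivForm hΩ (hF'.1 _ huY) - derivForm hΩ (hF'.1 _ hyY))
    (fun _ _ => rfl) hb (hvv t ht) (Vg_sub hw' hw) hz
  rw [hmv, pairG', add_sub_add_left_eq_sub]
  exact e1

end Residual

/-! ### The conditions on h hold for small h -/

section Asymptotics

lemma exists_forall_le_of_eventually {A : Set ℝ} (hA : ∀ h ∈ A, 0 < h) {P : ℝ → Prop}
    (hP : ∀ᶠ h in 𝓝[A] 0, P h) : ∃ b > 0, ∀ h ∈ A, h ≤ b → P h := by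
  obtain ⟨η, hη, hs⟩ := Metric.mem_nhdsWithin_iff.mp hP
  refine ⟨η / 2, by positivity, fun h hh hle => hs ⟨?_, hh⟩⟩
  rw [Metric.mem_ball, Real.dist_eq, sub_zero, abs_of_pos (hA h hh)]
  linarith

lemma tendsto_rpow_nhdsWithin_zero (A : Set ℝ) {a : ℝ} (ha : 0 < a) :
    Tendsto (fun h : ℝ => h ^ a) (𝓝[A] 0) (𝓝 0) := by
  have := (Real.continuousAt_rpow_const 0 a (Or.inr ha.le)).tendsto
  rw [Real.zero_rpow ha.ne'] at this
  exact this.mono_left nhdsWithin_le_nhds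

lemma tendsto_mul_rpow_of_isLittleO {A : Set ℝ} (hA : ∀ h ∈ A, 0 < h) {a : ℝ} {L : ℝ → ℝ}
    (hL : L =o[𝓝[A] 0] fun h => h ^ (2 - a)) :
    Tendsto (fun h => L h * h ^ (a - 2)) (𝓝[A] 0) (𝓝 0) := by
  refine hL.tendsto_div_nhds_zero.congr' ?_
  filter_upwards [self_mem_nhdsWithin] with h hh
  rw [← neg_sub a 2, Real.rpow_neg (hA h hh).le, div_inv_eq_mul]

/-- The smallness conditions on the mesh size hold for all small mesh sizes. -/
lemma exists_mesh_threshold {A : Set ℝ} (hA : ∀ h ∈ A, 0 < h) {a c D d b : ℝ} {L : ℝ → ℝ}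
    (hc : 0 < c) (ha : 2 < a) (hD : 0 ≤ D) (hd : 0 ≤ d) (hb : 0 ≤ b) (hL0 : ∀ h ∈ A, 0 ≤ L h)
    (hL : L =o[𝓝[A] 0] fun h => h ^ (2 - a)) :
    ∃ h₂ > 0, ∀ h ∈ A, h ≤ h₂ → D * max d (b * L h) * h ^ (a - 2) ≤ c := by
  refine exists_forall_le_of_eventually hA ?_
  have h1 := (((tendsto_rpow_nhdsWithin_zero A (sub_pos.mpr ha)).const_mul d).add
    ((tendsto_mul_rpow_of_isLittleO hA hL).const_mul b)).const_mul D
  simp only [mul_zero, add_zero] at h1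
  filter_upwards [h1.eventually (ge_mem_nhds hc), self_mem_nhdsWithin] with h hh hmem
  refine le_trans ?_ hh
  have hp : 0 < h ^ (a - 2) := Real.rpow_pos_of_pos (hA h hmem) _
  have hbL := mul_nonneg hb (hL0 h hmem)
  calc D * max d (b * L h) * h ^ (a - 2) ≤ D * (d + b * L h) * h ^ (a - 2) := by
        gcongr
        exact max_le (by linarith) (by linarith)
    _ = _ := by ring

end Asymptotics

/-! ### Existence, local uniqueness and the duality estimate -/

section Method

variable {n : ℕ} {Ω : Set (E n)} {F : (Fin n → Fin n → ℝ) → E n → ℝ → E n → ℝ} {g : E n → ℝ}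
  {k : ℕ} {S : ConformingFE Ω k} {Y : Submodule ℝ (L2 Ω)}

/-- Existence and local uniqueness of a solution of the method near `ũ`, from stability of the
linearized method, consistency of `ũ`, and the local Lipschitz bound for `F'`. -/
lemma exists_isFEMSolution (hΩ : IsOpen Ω) (hF' : IsDerivativeOn (Ω := Ω) F g Y)
    {ε h : ℝ} (hh : h ∈ S.sizes) (hVY : S.Vh h ≤ Y) {u ũ : L2 Ω} (huY : u ∈ Y)
    (hu : IsMomentSolution Ω F g ε u) (hũ : ũ ∈ S.Vhg g h) {β Φ η a ρ δ Λ : ℝ} (hΦ : 0 ≤ Φ)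
    (hΛ : 0 ≤ Λ)
    (hstab : ∀ v ∈ S.V0h h, ∀ Ψ, 0 ≤ Ψ →
      (∀ w ∈ S.V0h h, pairG' Ω F ε u v w ≤ Ψ * hNorm Ω 2 w) → hNorm Ω 2 v ≤ β * Ψ)
    (hcons : ∀ z ∈ V0 Ω, |ε * inner ℝ (lap Ω (ũ - u)) (lap Ω z) +
      (pairF Ω F ũ z - pairF Ω F u z)| ≤ Φ * hNorm Ω 2 z)
    (hlip : ∀ w ∈ S.Vhg g h, hNorm Ω 2 (ũ - w) ≤ δ →
      vvNorm Ω (fun v z => pairF' Ω F u v z - pairF' Ω F w v z) ≤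
        ENNReal.ofReal (Λ * hNorm Ω 2 (u - w)))
    (hη : hNorm Ω 2 (u - ũ) ≤ η) (ha : β * Φ ≤ a) (haρ : 2 * a ≤ ρ) (hρδ : ρ ≤ δ)
    (hc : β * (Λ * (η + ρ)) ≤ 1 / 2) (hρ : 0 ≤ ρ) :
    ∃ uh, S.IsFEMSolution F g ε h uh ∧ hNorm Ω 2 (ũ - uh) ≤ 2 * a ∧
      ∀ v, S.IsFEMSolution F g ε h v → hNorm Ω 2 (ũ - v) ≤ ρ → v = uh := by
  have hfin := ConformingFE.finiteDimensional_V0h hh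
  have hle := ConformingFE.V0h_le hh
  have hVg : ∀ {w}, w ∈ S.Vhg g h → w ∈ Vg Ω g := fun hw => ConformingFE.Vhg_subset hh hw
  have hY : ∀ {w}, w ∈ S.Vhg g h → w ∈ Y := fun hw => hVY hw.1
  have hũx : ∀ x : S.V0h h, ũ + x ∈ S.Vhg g h := fun x => ConformingFE.Vhg_add hũ x.2
  have hI : ∀ x : S.V0h h, ∀ z ∈ V0 Ω,
      Integrable (fun y => opF Ω F (ũ + x : L2 Ω) y * z y) (volume.restrict Ω) :=
    fun x z hz => hF'.2.1 _ (hY (hũx x)) (hVg (hũx x)) z hz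
  let ι := Submodule.inclusion hle
  let A : S.V0h h →ₗ[ℝ] S.V0h h →ₗ[ℝ] ℝ :=
    (linForm hΩ ε (hF'.1 u huY)).compl₁₂ ι ι
  have hA : ∀ v w : S.V0h h, A v w = pairG' Ω F ε u v w := fun v w =>
    linForm_apply hΩ ε (hF'.1 u huY) (ι v) (ι w)
  let R : S.V0h h → S.V0h h →ₗ[ℝ] ℝ := fun x =>
    (residual hΩ ε (Vg_sub (hVg (hũx x)) hu.1) (hF'.2.1 u huY hu.1) (hI x)).comp ι
  have hR : ∀ x z : S.V0h h, R x z = ε * inner ℝ (lap Ω (ũ + x - u)) (lap Ω (z : L2 Ω)) +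
      (pairF Ω F (ũ + x) z - pairF Ω F u z) := fun x z =>
    residual_apply hΩ ε _ _ _ (ι z)
  have hsol : ∀ x : S.V0h h, S.IsFEMSolution F g ε h (ũ + x) ↔ R x = 0 := by
    intro x
    have hz : ∀ z : S.V0h h, MomentEq Ω F ε (ũ + x) z ↔ R x z = 0 := by
      intro z
      rw [hR]
      exact momentEq_iff hΩ hu.1.1 (hVg (hũx x)).1 (hI x z (hle z.2)) (hu.2 z (hle z.2))
    constructor
    · intro hs
      ext z
      exact (hz z).mp (hs.2 z z.2)
    · intro h0
      refine ⟨hũx x, fun z hz' => (hz ⟨z, hz'⟩).mpr ?_⟩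
      rw [h0, LinearMap.zero_apply]
  have hH : ∀ x : S.V0h h, (x : L2 Ω) ∈ H Ω 2 := fun x => (hle x.2).1
  obtain ⟨x, hx, hx0, hxu⟩ := exists_unique_zero_of_contraction
    (q := fun x : S.V0h h => hNorm Ω 2 (x : L2 Ω))
    (fun x y => hNorm_add_le hΩ (hH x) (hH y)) (fun c x => hNorm_smul hΩ c (hH x))
    (fun x hx => Subtype.ext (eq_zero_of_hNorm_le_zero hΩ hx)) A R hΦ
    (lam := Λ * (η + ρ)) (mul_nonneg hΛ (add_nonneg ((hNorm_nonneg _ _).trans hη) hρ))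
    (fun v Ψ hΨ hv => hstab v v.2 Ψ hΨ fun w hw => by
      have := hv ⟨w, hw⟩
      rwa [hA] at this)
    (fun z => by
      rw [hR, ZeroMemClass.coe_zero, add_zero]
      exact (le_abs_self _).trans (hcons z (hle z.2)))
    ha haρ
    (fun x y hx hy z => by
      have hdiff : (ũ + x : L2 Ω) - (ũ + y) = x - y := by abel
      have hb : 0 ≤ Λ * (η + ρ) := mul_nonneg hΛ (add_nonneg ((hNorm_nonneg _ _).trans hη) hρ)
      have e1 := abs_linearization_error_le (ε := ε) (z := (z : L2 Ω)) hΩ hF' hb huY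
        (hY (hũx y)) (hVg (hũx y)) (hY (hũx x)) (hVg (hũx x)) (hle z.2) (by
          intro t ht
          rw [hdiff]
          have hxt : ((y + t • (x - y) : S.V0h h) : L2 Ω) = y + t • (x - y : L2 Ω) := by simp
          have hw : ũ + y + t • (x - y : L2 Ω) ∈ S.Vhg g h := by
            have := hũx (y + t • (x - y))
            rwa [hxt, ← add_assoc] at this
          -- The ball is convex, so the mean value point is a discrete function within ρ ≤ δ of ũ.
          -- There [A5] applies, with distance to u at most η + ρ.
          have hyt : hNorm Ω 2 (y + t • (x - y : L2 Ω)) ≤ ρ := by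
            have e : (y + t • (x - y : L2 Ω) : L2 Ω) = (1 - t) • (y : L2 Ω) + t • (x : L2 Ω) := by
              module
            rw [e]
            refine (hNorm_add_le hΩ (Submodule.smul_mem _ _ (hH y))
              (Submodule.smul_mem _ _ (hH x))).trans ?_
            rw [hNorm_smul hΩ _ (hH y), hNorm_smul hΩ _ (hH x), abs_of_pos ht.1,
              abs_of_pos (sub_pos.mpr ht.2)]
            nlinarith [mul_le_mul_of_nonneg_left hx ht.1.le,
              mul_le_mul_of_nonneg_left hy (sub_pos.mpr ht.2).le]
          have hm : (y + t • (x - y : L2 Ω) : L2 Ω) ∈ H Ω 2 := by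
            rw [← hxt]
            exact hH _
          refine (hlip _ hw ?_).trans (ENNReal.ofReal_le_ofReal
            (mul_le_mul_of_nonneg_left ?_ hΛ))
          · rw [add_assoc, sub_add_cancel_left, hNorm_neg hΩ hm]
            exact hyt.trans hρδ
          · rw [add_assoc, ← sub_sub]
            exact (hNorm_sub_le hΩ (sub_mem hu.1.1 (hVg hũ).1) hm).trans (add_le_add hη hyt))
      rw [hdiff] at e1
      have e2 : R x z - R y z = ε * inner ℝ (lap Ω (x - y : L2 Ω)) (lap Ω (z : L2 Ω)) +
          (pairF Ω F (ũ + x) z - pairF Ω F (ũ + y) z) := by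
        have e3 : (ũ + x - u : L2 Ω) = (x - y) + (ũ + y - u) := by abel
        rw [hR, hR, e3, lap_add hΩ (sub_mem (hH x) (hH y)) (sub_mem (hVg (hũx y)).1 hu.1.1),
          inner_add_left]
        ring
      rw [e2, hA]
      exact (le_abs_self _).trans e1)
    hc
  refine ⟨ũ + x, (hsol x).mpr hx0, ?_, fun v hv hvρ => ?_⟩
  · rw [sub_add_cancel_left, hNorm_neg hΩ (hH x)]
    exact hx
  · have hd : v - ũ ∈ S.V0h h := ConformingFE.Vhg_sub hv.1 hũ
    have hvx : v = ũ + ((⟨v - ũ, hd⟩ : S.V0h h) : L2 Ω) := by simp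
    rw [hNorm_sub_comm hΩ (hVg hũ).1 (hVg hv.1).1] at hvρ
    have := hxu ⟨v - ũ, hd⟩ hvρ ((hsol _).mp (hvx ▸ hv))
    rw [hvx, this]

/-- Duality estimate for the error in `L²`. -/
lemma norm_sub_le_of_dual (hΩ : IsOpen Ω) (hF' : IsDerivativeOn (Ω := Ω) F g Y)
    {ε h : ℝ} (hh : h ∈ S.sizes) (hVY : S.Vh h ≤ Y) {u uh z : L2 Ω} (huY : u ∈ Y)
    (hu : IsMomentSolution Ω F g ε u) (huh : S.IsFEMSolution F g ε h uh) (hz : z ∈ V0 Ω)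
    (hdual : ∀ w ∈ V0 Ω, pairG' Ω F ε u w z = inner ℝ (u - uh) w) {B b₁ b₂ Λ d : ℝ}
    (hΛ : 0 ≤ Λ) (hB : 0 ≤ B)
    (hcont : ∀ v ∈ V0 Ω, ∀ w ∈ V0 Ω, |pairG' Ω F ε u v w| ≤ B * hNorm Ω 2 v * hNorm Ω 2 w)
    (hz1 : hNorm Ω 2 (z - S.interp h z) ≤ b₁ * ‖u - uh‖)
    (hz2 : hNorm Ω 2 (S.interp h z) ≤ b₂ * ‖u - uh‖) (hd : hNorm Ω 2 (u - uh) ≤ d)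
    (hb₁ : 0 ≤ b₁) (hb₂ : 0 ≤ b₂)
    (hlip : ∀ γ ∈ Icc (0 : ℝ) 1, vvNorm Ω (fun v z => pairF' Ω F u v z -
        pairF' Ω F (u + γ • (uh - u)) v z) ≤ ENNReal.ofReal (Λ * hNorm Ω 2 (γ • (uh - u)))) :
    ‖u - uh‖ ≤ B * d * b₁ + Λ * d ^ 2 * b₂ := by
  have hI : S.interp h z ∈ S.V0h h := ConformingFE.interp_mem_V0h hh hz
  have hI0 : S.interp h z ∈ V0 Ω := ConformingFE.V0h_le hh hI
  have huhV : uh ∈ Vg Ω g := ConformingFE.Vhg_subset hh huh.1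
  have huhY : uh ∈ Y := hVY huh.1.1
  have he : u - uh ∈ V0 Ω := Vg_sub hu.1 huhV
  have he' : uh - u ∈ V0 Ω := Vg_sub huhV hu.1
  have hd' : hNorm Ω 2 (uh - u) ≤ d := by rwa [hNorm_sub_comm hΩ huhV.1 hu.1.1]
  have hd0 : 0 ≤ d := (hNorm_nonneg _ _).trans hd
  have e1 : ‖u - uh‖ ^ 2 = pairG' Ω F ε u (u - uh) (z - S.interp h z) +
      pairG' Ω F ε u (u - uh) (S.interp h z) := by
    rw [← pairG'_add_right hΩ hF' ε huY he (sub_mem hz hI0) hI0, sub_add_cancel, hdual _ he,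
      real_inner_self_eq_norm_sq]
  have e2 : pairG' Ω F ε u (u - uh) (z - S.interp h z) ≤ B * d * (b₁ * ‖u - uh‖) := by
    refine ((le_abs_self _).trans (hcont _ he _ (sub_mem hz hI0))).trans ?_
    have := hNorm_nonneg (Ω := Ω) 2 (z - S.interp h z)
    gcongr
  -- Galerkin orthogonality in nonlinear form: the residual of `uh` vanishes on the interpolant, so
  -- the linearized form there is pure linearization error, of size Λ d².
  have hres := (momentEq_iff hΩ hu.1.1 huhV.1 (hF'.2.1 uh huhY huhV _ hI0)
    (hu.2 _ hI0)).mp (huh.2 _ hI)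
  have e3 := abs_linearization_error_le (ε := ε) (b := Λ * d) hΩ hF' (by positivity) huY huY hu.1
    huhY huhV hI0 (fun t ht => by
      refine (hlip t ⟨ht.1.le, ht.2.le⟩).trans (ENNReal.ofReal_le_ofReal
        (mul_le_mul_of_nonneg_left ?_ hΛ))
      rw [hNorm_smul hΩ t he'.1, abs_of_pos ht.1]
      nlinarith [hNorm_nonneg (Ω := Ω) 2 (uh - u), ht.1, ht.2])
  rw [hres, sub_zero] at e3
  have e4 : pairG' Ω F ε u (u - uh) (S.interp h z) = -pairG' Ω F ε u (uh - u) (S.interp h z) := by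
    have h1 := LinearMap.map_neg₂ (linForm hΩ ε (hF'.1 u huY)) ⟨uh - u, he'⟩ ⟨_, hI0⟩
    rw [linForm_apply, linForm_apply] at h1
    rw [← h1, ← neg_sub uh u]
    rfl
  have e5 : pairG' Ω F ε u (u - uh) (S.interp h z) ≤ Λ * d * d * (b₂ * ‖u - uh‖) := by
    rw [e4]
    refine ((neg_le_abs _).trans e3).trans ?_
    have := hNorm_nonneg (Ω := Ω) 2 (S.interp h z)
    gcongr
  have e6 : ‖u - uh‖ * ‖u - uh‖ ≤ (B * d * b₁ + Λ * d ^ 2 * b₂) * ‖u - uh‖ := by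
    linarith
  rcases (norm_nonneg (u - uh)).eq_or_lt with h0 | h0
  · rw [← h0]
    positivity
  · exact le_of_mul_le_mul_right e6 h0

end Method

/-- Collecting the two contributions to the `L²` error. -/
lemma error_terms_le {h ℓ r K U C₂ CR Λ C₇ Γ Γ₂ : ℝ} (hh : 0 < h) (hC₇ : 0 < C₇) (hΓ₂ : 0 < Γ₂)
    (hΓ : 0 < Γ) (hC2 : 0 < C₂) (hCR : 0 < CR) (hL : 0 ≤ Λ) (hK : 0 ≤ K) (hU : 0 ≤ U) :
    Γ₂ * C₂ * (C₇ * (K * (h ^ (ℓ - 2) * U))) * (Γ * h ^ (r - 2) * CR) +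
        Λ * (C₇ * (K * (h ^ (ℓ - 2) * U))) ^ 2 * (Γ * CR) ≤
      (C₇ + Γ₂ * C₇ * Γ + C₇ ^ 2 * Γ) * K * CR *
        (C₂ * h ^ (ℓ + r - 4) * U + Λ * K * h ^ (2 * ℓ - 4) * U ^ 2) := by
  have p1 : h ^ (ℓ + r - 4) = h ^ (ℓ - 2) * h ^ (r - 2) := by
    rw [← Real.rpow_add hh]
    congr 1
    ring
  have p2 : h ^ (2 * ℓ - 4) = (h ^ (ℓ - 2)) ^ 2 := by
    rw [← Real.rpow_natCast, ← Real.rpow_mul hh.le]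
    congr 1
    push_cast
    ring
  have hη : 0 < h ^ (r - 2) := Real.rpow_pos_of_pos hh _
  have hζ : 0 < h ^ (ℓ - 2) := Real.rpow_pos_of_pos hh _
  rw [p1, p2]
  generalize h ^ (r - 2) = η at *
  generalize h ^ (ℓ - 2) = ζ at *
  have q1 : 0 ≤ (C₇ + C₇ ^ 2 * Γ) * K * CR * (C₂ * (ζ * η) * U) := by positivity
  have q2 : 0 ≤ (C₇ + Γ₂ * C₇ * Γ) * K * CR * (Λ * K * ζ ^ 2 * U ^ 2) := by positivity
  linarith

end VMM

/-! ### Choice of constants and conclusion -/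

set_option maxHeartbeats 1000000 in
theorem mainTheorem8 {n : ℕ} (hn : 1 ≤ n)
    -- a bounded convex domain, the nonlinearity `F`, the boundary data `g`
    (Ω : Set (E n)) (hΩo : IsOpen Ω) (hΩc : Convex ℝ Ω) (hΩb : Bornology.IsBounded Ω)
    (hΩn : Ω.Nonempty)
    (F : (Fin n → Fin n → ℝ) → E n → ℝ → E n → ℝ) (hF : DifferentiableNonlinearity Ω F)
    (g : E n → ℝ)
    -- the finite element spaces, of degree `k > 4`, with approximation orders `s` and `p`
    {k : ℕ} (hk : 4 < k) (S : ConformingFE Ω k) (s p : ℝ)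
    (hSs : S.Approximates s) (hSp : S.Approximates p)
    (ε₀ : ℝ) (u : ℝ → L2 Ω) (C₀ C₁ C₂ CR δ : ℝ → ℝ) (L : ℝ → ℝ → ℝ)
    (Y : Submodule ℝ (L2 Ω)) (N : L2 Ω → ℝ)
    (hI : ∀ ε ∈ Ioc 0 ε₀, ∀ h ∈ S.sizes, S.interp h (u ε) ∈ S.Vhg g h)
    -- the structure assumptions
    (hF' : IsDerivativeOn (Ω := Ω) F g Y)
    (h1 : A1 F g ε₀ s u) (h2 : A2 F ε₀ p u C₀ C₁ C₂ CR) (h3 : A3 F ε₀ u Y N S)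
    (h4 : A4 ε₀ u N S) (h5 : A5 F g ε₀ s u δ L S)
    -- normalization of the constants
    (κ : ℝ) (hκ₂ : ∀ ε ∈ Ioc 0 ε₀, ε ≤ κ * C₂ ε)
    (hκY : ∀ ε ∈ Ioc 0 ε₀, max ε (C₁ ε) ≤ κ * N (u ε)) :
    ∃ c > 0, ∃ C > 0, ∀ ε ∈ Ioc 0 ε₀,
      ∀ ℓ r M K U : ℝ, ℓ = min s ((k : ℝ) + 1) → r = min p ((k : ℝ) + 1) →
      M = cM (C₀ ε) (C₁ ε) (CR ε) → K = cK (C₀ ε) (C₁ ε) (CR ε) (N (u ε)) →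
      U = hsNorm Ω ℓ (u ε) →
      -- the two smallness conditions on `h` hold for all small `h`
      (∃ h₂ > 0, ∀ h ∈ S.sizes, h ≤ h₂ →
        K * U * max (δ ε)⁻¹ (C₁ ε ^ (-(1 / 2) : ℝ) * L ε h * M) * h ^ (ℓ - 2) ≤ c) ∧
      (∃ h₃ > 0, ∀ h ∈ S.sizes, h ≤ h₃ → K * (δ ε)⁻¹ * U * h ^ (ℓ - 2) ≤ c) ∧
      -- existence, local uniqueness and error estimates
      ∀ h ∈ S.sizes, h ≤ h0 c (C₀ ε) (C₁ ε) (C₂ ε) (CR ε) r →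
        K * U * max (δ ε)⁻¹ (C₁ ε ^ (-(1 / 2) : ℝ) * L ε h * M) * h ^ (ℓ - 2) ≤ c →
        ∃ uh : L2 Ω, S.IsFEMSolution F g ε h uh ∧
          (∃ ρ > 0, hNorm Ω 2 (S.interp h (u ε) - uh) < ρ ∧
            ∀ v, S.IsFEMSolution F g ε h v →
              hNorm Ω 2 (S.interp h (u ε) - v) ≤ ρ → v = uh) ∧
          hNorm Ω 2 (u ε - uh) ≤ C * K * h ^ (ℓ - 2) * U ∧
          (LipschitzOnSegments F g u δ L S ε h →
            K * (δ ε)⁻¹ * U * h ^ (ℓ - 2) ≤ c →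
            ‖u ε - uh‖ ≤ C * K * CR ε *
              (C₂ ε * h ^ (ℓ + r - 4) * U + L ε h * K * h ^ (2 * ℓ - 4) * U ^ 2)) := by
  obtain ⟨hε₀, -, hs3, hA1⟩ := h1
  obtain ⟨hYH, hN, hVY, huY, C₃, hC₃, hvv⟩ := h3
  obtain ⟨C₄, hC₄, hNI⟩ := h4
  have hN0 : ∀ y ∈ Y, 0 ≤ N y := by
    intro y hy
    have e0 : N 0 = 0 := by simpa using hN.2 0 0 (zero_mem Y)
    have e1 : N (-y) = N y := by simpa using hN.2 (-1) y hy
    have e2 := hN.1 y hy (-y) (neg_mem hy)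
    rw [add_neg_cancel, e0, e1] at e2
    linarith
  have hκ : 0 < κ := by
    have hmem : ε₀ ∈ Ioc 0 ε₀ := ⟨hε₀, le_rfl⟩
    exact pos_of_mul_pos_left (hε₀.trans_le (hκ₂ ε₀ hmem)) (h2.2 ε₀ hmem).2.2.1.le
  obtain ⟨c₀, hc₀, Cs, hCs, hstab⟩ :=
    exists_discrete_stability hΩo hn hΩb hΩn hk hSp h2 hF' huY hκ hκ₂
  obtain ⟨Γ, hΓ, hdual⟩ := exists_dual_solution hΩo hn hΩb hΩn hk hSp h2
  obtain ⟨Ca, hCa, happ⟩ := hSs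
  set C₆ := κ * (n : ℝ) ^ 2 + C₃ * (1 + C₄) with hC₆
  have hC₆0 : 0 < C₆ := by positivity
  set C₇ := Ca * κ + 2 * (Cs * C₆ * Ca) with hC₇
  have hC₇0 : 0 < C₇ := by positivity
  set Γ₂ := κ * (n : ℝ) ^ 2 + 1 with hΓ₂
  have hΓ₂0 : 0 < Γ₂ := by positivity
  -- The three entries of the minimum give discrete stability, 2a' ≤ δ/2, and the contraction bound,
  -- in this order.
  refine ⟨min c₀ (min (1 / (4 * (Cs * C₆ * Ca))) (1 / (4 * (Cs * C₇)))), by positivity,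
    C₇ + Γ₂ * C₇ * Γ + C₇ ^ 2 * Γ, by positivity, ?_⟩
  intro ε hε ℓ r M K U hℓ hr hM hK hU
  set c := min c₀ (min (1 / (4 * (Cs * C₆ * Ca))) (1 / (4 * (Cs * C₇)))) with hc
  have hcpos : 0 < c := by positivity
  have hk' : (4 : ℝ) < k := by exact_mod_cast hk
  have hℓ2 : 2 < ℓ := by
    rw [hℓ]
    exact lt_min (by linarith) (by linarith)
  obtain ⟨hC0, hC1, hC2, hCR, -⟩ := h2.2 ε hε
  obtain ⟨hδ, hδ1, hL0, hLip, hLo⟩ := h5 ε hε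
  obtain ⟨hus, hsol, -⟩ := hA1 ε hε
  rw [← hℓ] at hLo
  have hM0 : 0 < M := hM ▸ cM_pos hC1
  set a := C₁ ε ^ (-(1 / 2) : ℝ) with ha
  have ha0 : 0 < a := Real.rpow_pos_of_pos hC1 _
  have hNu : 0 ≤ N (u ε) := hN0 _ (huY ε hε)
  have hKe : K = a * N (u ε) * M := by rw [hK, hM, cK]
  have hK0 : 0 ≤ K := by rw [hKe]; positivity
  have hU0 : 0 ≤ U := hU ▸ hsNorm_nonneg _ _
  have hKU := mul_nonneg hK0 hU0
  refine ⟨exists_mesh_threshold S.sizes_pos hcpos hℓ2 hKU (inv_nonneg.mpr hδ.le)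
    (mul_nonneg ha0.le hM0.le) hL0 hLo |>.imp fun h₂ hh₂ => ⟨hh₂.1, fun h hh hle => ?_⟩,
    -- With b = 0 the maximum collapses to δ⁻¹, which is (H3).
    exists_mesh_threshold (b := 0) S.sizes_pos hcpos hℓ2 hKU (inv_nonneg.mpr hδ.le) le_rfl hL0
      hLo |>.imp fun h₃ hh₃ => ⟨hh₃.1, fun h hh hle => ?_⟩, ?_⟩
  · have := hh₂.2 h hh hle
    rwa [mul_right_comm a M] at this
  · have := hh₃.2 h hh hle
    rw [zero_mul, max_eq_left (inv_nonneg.mpr hδ.le)] at this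
    rwa [mul_right_comm K]
  intro h hh hh0 hH2
  have hhpos := S.sizes_pos h hh
  set T := h ^ (ℓ - 2) * U with hT
  have hp0 : 0 < h ^ (ℓ - 2) := Real.rpow_pos_of_pos hhpos _
  have hT0 : 0 ≤ T := by positivity
  -- The normalization C₁ ≤ κ‖u‖_Y keeps K away from zero, so the interpolation error is absorbed
  -- into the bound with factor K.
  have hκK : 1 ≤ κ * K := by
    have e1 : C₁ ε * (C₁ ε)⁻¹ = 1 := mul_inv_cancel₀ hC1.ne'
    have e2 : C₁ ε ≤ κ * N (u ε) := (le_max_right _ _).trans (hκY ε hε)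
    have e3 : (C₁ ε)⁻¹ ≤ a * M := by
      rw [← rpow_neg_half_sq hC1, sq, hM]
      exact mul_le_mul_of_nonneg_left (le_max_left _ _) ha0.le
    calc (1 : ℝ) = C₁ ε * (C₁ ε)⁻¹ := e1.symm
      _ ≤ (κ * N (u ε)) * (a * M) := by gcongr
      _ = κ * K := by rw [hKe]; ring
  have hTK : T ≤ κ * (K * T) := by
    rw [← mul_assoc]
    exact le_mul_of_one_le_left hT0 hκK
  set ũ := S.interp h (u ε) with hũ
  have hũg : ũ ∈ S.Vhg g h := hI ε hε h hh
  have hũV : ũ ∈ Vg Ω g := ConformingFE.Vhg_subset hh hũg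
  have hη : hNorm Ω 2 (u ε - ũ) ≤ Ca * T := by
    have := happ h hh (u ε) hsol.1.1 hus 2 le_rfl
    rwa [← hℓ, ← hU, Nat.cast_ofNat, mul_assoc] at this
  have hKT0 : 0 ≤ K * T := mul_nonneg hK0 hT0
  have hH2' : K * T * max (δ ε)⁻¹ (a * L ε h * M) ≤ c := by
    rw [hT]
    linarith
  have hH2a : K * T ≤ c * δ ε := by
    have := (mul_le_mul_of_nonneg_left (le_max_left (δ ε)⁻¹ (a * L ε h * M)) hKT0).trans hH2'
    rwa [← div_eq_mul_inv, div_le_iff₀ hδ] at this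
  have hH2b : K * T * (a * L ε h * M) ≤ c :=
    (mul_le_mul_of_nonneg_left (le_max_right _ _) hKT0).trans hH2'
  have hL := hL0 h hh
  set β := Cs * (a * M) with hβ
  have hβ0 : 0 < β := by positivity
  -- This is the stability constant β times the consistency error of ũ, that is, a bound for the
  -- first Newton step.
  set a' := Cs * C₆ * Ca * (K * T) with ha'
  have ha'0 : 0 ≤ a' := by positivity
  have hcc : c * (4 * (Cs * C₆ * Ca)) ≤ 1 := by
    have : c ≤ 1 / (4 * (Cs * C₆ * Ca)) := (min_le_right _ _).trans (min_le_left _ _)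
    rwa [le_div_iff₀ (by positivity)] at this
  have hcc' : c * (4 * (Cs * C₇)) ≤ 1 := by
    have : c ≤ 1 / (4 * (Cs * C₇)) := (min_le_right _ _).trans (min_le_right _ _)
    rwa [le_div_iff₀ (by positivity)] at this
  have ha'δ : 2 * a' ≤ δ ε / 2 := by
    have e1 : a' ≤ Cs * C₆ * Ca * (c * δ ε) := mul_le_mul_of_nonneg_left hH2a (by positivity)
    have e2 := mul_le_mul_of_nonneg_right hcc hδ.le
    linarith
  -- The slack θ makes the uniqueness ball strictly larger than the distance 2a'. It keeps the
  -- radius below δ and adds at most 1/4 to the contraction bound; the +1 covers L(h) = 0.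
  set θ := min (δ ε / 2) (1 / (4 * (β * L ε h) + 1)) with hθ
  have hβL : 0 ≤ β * L ε h := mul_nonneg hβ0.le hL
  have hθ0 : 0 < θ := lt_min (by linarith) (by positivity)
  have hηK : Ca * T ≤ Ca * κ * (K * T) := by
    rw [mul_assoc]
    exact mul_le_mul_of_nonneg_left hTK hCa.le
  have hsmall : β * (L ε h * (Ca * T + (2 * a' + θ))) ≤ 1 / 2 := by
    have e1 : β * L ε h * θ ≤ 1 / 4 := by
      have : θ * (4 * (β * L ε h) + 1) ≤ 1 := by
        rw [← le_div_iff₀ (by positivity)]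
        exact min_le_right _ _
      linarith
    have e2 : β * L ε h * (Ca * T + 2 * a') ≤ 1 / 4 := by
      calc β * L ε h * (Ca * T + 2 * a') ≤ β * L ε h * (C₇ * (K * T)) := by
            refine mul_le_mul_of_nonneg_left ?_ hβL
            rw [hC₇]
            linarith
        _ = Cs * C₇ * (K * T * (a * L ε h * M)) := by rw [hβ]; ring
        _ ≤ Cs * C₇ * c := mul_le_mul_of_nonneg_left hH2b (by positivity)
        _ ≤ 1 / 4 := by linarith
    linarith
  obtain ⟨uh, huh, huh1, huh2⟩ := exists_isFEMSolution (Φ := C₆ * N (u ε) * (Ca * T))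
    (β := β) (a := a') (ρ := 2 * a' + θ) (δ := δ ε) hΩo hF' hh (hVY h hh) (huY ε hε) hsol hũg
    (by positivity) hL
    (fun v hv Ψ hΨ hw => by
      rw [hβ, ha, hM]
      exact hstab c (min_le_left _ _) ε hε h hh (hr ▸ hh0) v hv Ψ hΨ hw)
    (fun z hz => by
      refine (abs_residual_le hΩo hF' hN hε.1.le hC₃.le hC₄.le hvv (huY ε hε) hsol.1
        (hVY h hh hũg.1) hũV hz hNu (hNI ε hε h hh)
        ((le_max_left _ _).trans (hκY ε hε))).trans ?_
      rw [hNorm_sub_comm hΩo hũV.1 hsol.1.1]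
      have := hNorm_nonneg (Ω := Ω) 2 z
      gcongr)
    (hLip h hh) hη (le_of_eq (by rw [hβ, ha', hKe]; ring)) (by linarith)
    (by linarith [min_le_left (δ ε / 2) (1 / (4 * (β * L ε h) + 1))]) hsmall
    (by positivity)
  have huhV : uh ∈ Vg Ω g := ConformingFE.Vhg_subset hh huh.1
  have herr : hNorm Ω 2 (u ε - uh) ≤ C₇ * (K * T) := by
    have e1 := hNorm_add_le hΩo (sub_mem hsol.1.1 hũV.1) (sub_mem hũV.1 huhV.1)
    rw [sub_add_sub_cancel] at e1
    rw [hC₇]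
    linarith
  refine ⟨uh, huh, ⟨2 * a' + θ, by positivity, by linarith, huh2⟩, ?_, fun hseg _ => ?_⟩
  · refine herr.trans ?_
    have e1 : 0 ≤ (Γ₂ * C₇ * Γ + C₇ ^ 2 * Γ) * (K * T) := by positivity
    rw [hT] at e1 ⊢
    linarith
  · have hη0 : 0 < h ^ (r - 2) := Real.rpow_pos_of_pos hhpos _
    obtain ⟨z, hz, hzw, hz1, hz2⟩ := hdual ε hε h hh (u ε - uh)
    rw [← hr] at hz1
    have e1 := norm_sub_le_of_dual (B := Γ₂ * C₂ ε) (Λ := L ε h) hΩo hF' hh (hVY h hh)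
      (huY ε hε) hsol huh hz hzw hL (by positivity)
      (fun v hv w hw => abs_pairG'_le hΩo hF' h2 hκ₂ hε (huY ε hε) hv hw) hz1 hz2 herr
      (by positivity) (by positivity)
      -- The solution lies within 2a' ≤ δ/2 of ũ, so the segment from u^ε to it is admissible.
      (hseg uh huh.1 (by
        have := min_le_left (δ ε / 2) (1 / (4 * (β * L ε h) + 1))
        linarith))
    exact e1.trans (error_terms_le hhpos hC₇0 hΓ₂0 hΓ hC2 hCR hL hK0 hU0)
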